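/- Let $f:[0,1]^2\to(0,\infty)$ be Riemann-integrable (in the proper sense, so $f$ is bounded), and assume that, as a function on $[0,1]^2$, $f$ is continuous at $(0,y)$ for Lebesgue-almost every $y\in[0,1]$ and at $(x,1)$ for Lebesgue-almost every $x\in[0,1]$. Let $\gamma>0$. For $n\ge 1$ let $G(n,f,\gamma)$ be the random directed graph with vertex set $\{1,\dots,n\}$ in which, independently for all $1\le i<j\le n$, the directed edge $(i,j)$ is present with probability $p^{(n)}_{i,j}=f(i/n,j/n)/n^{\gamma}$ (replaced by $1$ if it exceeds $1$, which happens only for finitely many $n$). Let $L_n\in\{0,1,2,\dots\}\cup\{\infty\}$ be the number of edges of a shortest directed path from $1$ to $n$ in $G(n,f,\gamma)$, with $L_n=\infty$ if there is no such path. For $k\ge 2$ put $$c_k(f)=\int_{0<u_1<\dots<u_{k-1}<1}\ \prod_{j=0}^{k-1} f(u_j,u_{j+1})\,du_1\cdots du_{k-1},\qquad u_0=0,\ u_k=1 .$$ Then for every $k\ge 2$ the integrand is Lebesgue-integrable on this domain, so that $c_k(f)<\infty$, and, with the convention $\frac1{1-\gamma}=+\infty$ for $\gamma\ge 1$, $$\lim_{n\to\infty}\mathbb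 P(L_n\le k)=\begin{cases}0 & \text{if } k<\frac1{1-\gamma},\\[2pt] 1-e^{-c_k(f)} & \text{if } k=\frac1{1-\gamma},\\[2pt] 1 & \text{if } k>\frac1{1-\gamma}.\end{cases}$$ -/

import Mathlib

open MeasureTheory Set Filter Topology

namespace BarakErdos

/-! ### Riemann integrability on the unit square -/

/-- The unit square, as a box in `ℝ²` (its closed version `Box.Icc` is `[0,1]²`). -/
def unitSquare : BoxIntegral.Box (Fin 2) where
  lower := fun _ => 0
  upper := fun _ => 1
  lower_lt_upper := fun _ => zero_lt_one

/-- `f` is Riemann-integrable on `[0,1]²`: its Riemann sums over tagged partitions of the square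
into boxes converge as the mesh tends to `0`. -/
def RiemannIntegrable (f : ℝ → ℝ → ℝ) : Prop :=
  BoxIntegral.Integrable unitSquare BoxIntegral.IntegrationParams.Riemann
    (fun x : Fin 2 → ℝ => f (x 0) (x 1))
    (BoxIntegral.BoxAdditiveMap.volume : BoxIntegral.BoxAdditiveMap (Fin 2) (ℝ →L[ℝ] ℝ) ⊤)

/-! ### The random graph `G(n, f, γ)` -/

/-- The vertex set `{1, …, n}`. -/
abbrev Vertex (n : ℕ) : Type := {i : ℕ // i ∈ Finset.Icc 1 n}

/-- The potential directed edges `(i, j)`, `1 ≤ i < j ≤ n`. -/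
abbrev Edge (n : ℕ) : Type := {e : Vertex n × Vertex n // e.1 < e.2}

/-- An edge configuration: which of the potential edges are present. -/
abbrev Config (n : ℕ) : Type := Edge n → Bool

/-- The directed graph on `{1, …, n}` determined by an edge configuration. -/
def graph {n : ℕ} (ω : Config n) : Digraph (Vertex n) where
  Adj i j := ∃ h : i < j, ω ⟨(i, j), h⟩ = true

/-- The probability `f(i/n, j/n) / n ^ γ` that the edge `(i, j)` is present. It is clipped to
`[0,1]`; for a bounded nonnegative `f` and `γ > 0` this changes nothing once `n` is large. -/
noncomputable def edgeProb (f : ℝ → ℝ → ℝ) (γ : ℝ) {n : ℕ} (e : Edge n) : unitInterval :=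
  Set.projIcc (0 : ℝ) 1 zero_le_one
    (f ((e.1.1 : ℕ) / (n : ℝ)) ((e.1.2 : ℕ) / (n : ℝ)) / (n : ℝ) ^ γ)

/-- The law of `G(n, f, γ)`: the edges are present independently, the edge `e` with probability
`edgeProb f γ e`. -/
noncomputable def law (f : ℝ → ℝ → ℝ) (γ : ℝ) (n : ℕ) : Measure (Config n) :=
  Measure.pi fun e => ProbabilityTheory.bernoulliMeasure true false (edgeProb f γ e)

/-- There is a directed path with `ℓ` edges from the vertex `1` to the vertex `n`. -/
def HasPath {n : ℕ} (G : Digraph (Vertex n)) (ℓ : ℕ) : Prop :=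
  ∃ ρ : Fin (ℓ + 1) → Vertex n,
    (ρ 0 : ℕ) = 1 ∧ (ρ (Fin.last ℓ) : ℕ) = n ∧ ∀ i : Fin ℓ, G.Adj (ρ i.castSucc) (ρ i.succ)

/-- The length `L_n` of the shortest path from `1` to `n`, equal to `∞` if there is no path. -/
noncomputable def shortestPath {n : ℕ} (G : Digraph (Vertex n)) : ℕ∞ :=
  ⨅ (ℓ : ℕ) (_ : HasPath G ℓ), (ℓ : ℕ∞)

/-- The probability that `L_n ≤ k` in `G(n, f, γ)`. -/
noncomputable def probShortestLE (f : ℝ → ℝ → ℝ) (γ : ℝ) (n k : ℕ) : ℝ :=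
  (law f γ n).real {ω | shortestPath (graph ω) ≤ (k : ℕ∞)}

/-! ### The constant `c_k(f)` -/

/-- The sequence `u_0 = 0, u_1, …, u_m, u_{m+1} = 1` built from `u_1, …, u_m`. -/
def gridPoints {m : ℕ} (u : Fin m → ℝ) : Fin (m + 2) → ℝ :=
  Fin.cons (α := fun _ => ℝ) 0 (Fin.snoc (α := fun _ => ℝ) u 1)

/-- The simplex `{0 < u_1 < ⋯ < u_m < 1}`. -/
def openSimplex (m : ℕ) : Set (Fin m → ℝ) := {u | StrictMono (gridPoints u)}

/-- The integrand `∏_{j=0}^{m} f(u_j, u_{j+1})`. -/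
def pathWeight (f : ℝ → ℝ → ℝ) {m : ℕ} (u : Fin m → ℝ) : ℝ :=
  ∏ j : Fin (m + 1), f (gridPoints u j.castSucc) (gridPoints u j.succ)

/-- `c_k(f)`, the integral of `∏_{j=0}^{k-1} f(u_j, u_{j+1})` over
`0 < u_1 < ⋯ < u_{k-1} < 1`, for `k ≥ 1`. -/
noncomputable def pathConst (f : ℝ → ℝ → ℝ) (k : ℕ) : ℝ :=
  ∫ u in openSimplex (k - 1), pathWeight f u

end BarakErdos

/-! Count the increasing paths from `1` to `n` with exactly `k` edges. There are at most `n ^ (k -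
1)` of them, and each is present with probability `∏ f / n ^ (γ k)`, so their expected number is a
Riemann sum for `c_k(f)` times `n ^ (k (1 - γ) - 1)`. The sign of this exponent separates the three
regimes.

Negative exponent: the union bound suffices, and it also disposes of all shorter paths. Zero
exponent: the probability of having no path is trapped between Harris' product `∏ (1 - P)`
(`prod_one_sub_le_noneTrue`) and Janson's bound `exp (-mean + overlap)` (`janson`), and both tend to
`exp (-c_k(f))`. Positive exponent: Chebyshev's inequality (`noneTrue_mul_sq_le`) applies, since the
mean diverges and the overlap is negligible against its square.

The overlap is controlled by a combinatorial fact (`card_inter_pathEdges_le`): distinct paths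
sharing `s` edges share at least `s` intermediate vertices. Each shared edge saves a factor of order
`n ^ γ` in probability, while each shared vertex costs a factor of order `n` in the count, which
wins as `γ < 1`.

The analytic input is convergence of the Riemann sums (`Admissible.tendsto_pathSum`). A
Riemann-integrable function is bounded and almost everywhere continuous, so the step functions
behind the sums converge almost everywhere and dominated convergence applies. The first and last
factors of the integrand see `f` only on two sides of the square, which are null sets; the
continuity hypotheses on these sides cover them. -/

namespace BarakErdos

/-! ### Riemann-integrable functions are bounded and almost everywhere continuous -/

section LebesgueCriterion

open BoxIntegral BoxIntegral.unitPartition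

variable {ι : Type*} [Fintype ι]

open scoped Classical in
/-- The partition of `B` into cubes of side `1 / n`, tagged by an arbitrary function. -/
noncomputable def retag (n : ℕ) [NeZero n] (B : Box ι) (s : (ι → ℤ) → (ι → ℝ))
    (hs : ∀ ν ∈ admissibleIndex n B, s ν ∈ Box.Icc (box n ν)) : TaggedPrepartition B where
  toPrepartition := (prepartition n B).toPrepartition
  tag J := if h : ∃ ν ∈ admissibleIndex n B, box n ν = J then s h.choose
    else (prepartition n B).tag J
  tag_mem_Icc J := by
    split_ifs with h
    · have h' := h.choose_spec
      exact (Box.le_iff_Icc.1 (mem_admissibleIndex_iff.1 h'.1)) (hs _ h'.1)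
    · exact (prepartition n B).tag_mem_Icc J

theorem retag_tag_box (n : ℕ) [NeZero n] (B : Box ι) (s : (ι → ℤ) → (ι → ℝ))
    (hs : ∀ ν ∈ admissibleIndex n B, s ν ∈ Box.Icc (box n ν)) {ν : ι → ℤ}
    (hν : ν ∈ admissibleIndex n B) : (retag n B s hs).tag (box n ν) = s ν := by
  have h : ∃ ν' ∈ admissibleIndex n B, box n ν' = box n ν := ⟨ν, hν, rfl⟩
  have : h.choose = ν := box_injective n h.choose_spec.2
  simp only [retag]
  rw [dif_pos h, this]

/-- Riemann gauges are constant, so being subordinate only requires that the cubes have diameter at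
most `1 / n`. No distortion bound is imposed, hence the parameter `0`. -/
theorem memBaseSet_retag (n : ℕ) [NeZero n] (B : Box ι) (s : (ι → ℤ) → (ι → ℝ))
    (hs : ∀ ν ∈ admissibleIndex n B, s ν ∈ Box.Icc (box n ν)) {r : (ι → ℝ) → Ioi (0 : ℝ)}
    (hr : ∀ x, r x = r 0) (hn : 1 / (n : ℝ) ≤ r 0) :
    IntegrationParams.Riemann.MemBaseSet B 0 r (retag n B s hs) where
  isSubordinate J hJ x hx := by
    obtain ⟨ν, hν, rfl⟩ := mem_prepartition_iff.1 hJ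
    rw [retag_tag_box n B s hs hν, hr, Metric.mem_closedBall]
    exact (Metric.dist_le_diam_of_mem (Box.isBounded_Icc _) hx (hs ν hν)).trans
      ((diam_boxIcc n ν).trans hn)
  isHenstock _ J hJ := by
    obtain ⟨ν, hν, rfl⟩ := mem_prepartition_iff.1 hJ
    rw [retag_tag_box n B s hs hν]
    exact hs ν hν
  distortion_le h := by simp [IntegrationParams.Riemann] at h
  exists_compl h := by simp [IntegrationParams.Riemann] at h

theorem integralSum_retag (n : ℕ) [NeZero n] (B : Box ι) (s : (ι → ℤ) → (ι → ℝ))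
    (hs : ∀ ν ∈ admissibleIndex n B, s ν ∈ Box.Icc (box n ν)) (F : (ι → ℝ) → ℝ) :
    integralSum F BoxAdditiveMap.volume (retag n B s hs) =
      (∑ ν ∈ admissibleIndex n B, F (s ν)) / (n : ℝ) ^ Fintype.card ι := by
  classical
  have h : (retag n B s hs).boxes = (admissibleIndex n B).image (fun ν => box n ν) := by
    ext J
    rw [Finset.mem_image]
    exact mem_prepartition_boxes_iff
  rw [integralSum, h, Finset.sum_image fun _ _ _ _ h => box_injective n h, Finset.sum_div]
  refine Finset.sum_congr rfl fun ν hν => ?_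
  rw [retag_tag_box n B s hs hν, BoxAdditiveMap.volume_apply]
  simp only [box.upper_sub_lower, Finset.prod_const, Finset.card_univ, smul_eq_mul]
  rw [one_div, inv_pow, mul_comm, div_eq_mul_inv]

/-- Changing the tags of a fine cubical partition hardly changes the Riemann sums. -/
theorem exists_abs_sum_sub_le {B : Box ι} (hB : hasIntegralVertices B) {F : (ι → ℝ) → ℝ}
    (hF : Integrable B IntegrationParams.Riemann F
      (BoxAdditiveMap.volume : BoxAdditiveMap ι (ℝ →L[ℝ] ℝ) ⊤))
    {ε : ℝ} (hε : 0 < ε) : ∃ (n : ℕ) (_ : NeZero n), ∀ s t : (ι → ℤ) → (ι → ℝ),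
      (∀ ν ∈ admissibleIndex n B, s ν ∈ Box.Icc (box n ν)) →
      (∀ ν ∈ admissibleIndex n B, t ν ∈ Box.Icc (box n ν)) →
      ∑ ν ∈ admissibleIndex n B, (F (s ν) - F (t ν)) ≤ ε * (n : ℝ) ^ Fintype.card ι := by
  obtain ⟨y, hy⟩ := hF
  obtain ⟨r, hr, H⟩ := hasIntegral_iff.1 hy (ε / 2) (half_pos hε)
  have hr0 : (0 : ℝ) < r 0 0 := (r 0 0).2
  obtain ⟨n, hn⟩ := exists_nat_one_div_lt hr0
  refine ⟨n + 1, ⟨n.succ_ne_zero⟩, fun s t hs ht => ?_⟩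
  have hle : 1 / ((n + 1 : ℕ) : ℝ) ≤ r 0 0 := by push_cast; exact hn.le
  have key : ∀ s hs, dist (integralSum F BoxAdditiveMap.volume (retag (n + 1) B s hs)) y ≤ ε / 2 :=
    fun s hs => H 0 _ (memBaseSet_retag (n + 1) B s hs (hr 0 rfl) hle)
      (prepartition_isPartition (n + 1) hB)
  have h := (dist_triangle_right _ _ _).trans (add_le_add (key s hs) (key t ht))
  rw [add_halves, Real.dist_eq, integralSum_retag, integralSum_retag, ← sub_div,
    ← Finset.sum_sub_distrib] at h
  exact (div_le_iff₀ (by positivity)).1 ((le_abs_self _).trans h)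

/-- The half-open cubes cover the half-open box, and a finite union of closed cubes is closed, so it
contains the closure of the box. -/
theorem Icc_subset_iUnion_box {B : Box ι} (hB : hasIntegralVertices B) (n : ℕ) [NeZero n] :
    Box.Icc B ⊆ ⋃ ν ∈ admissibleIndex n B, Box.Icc (box n ν) := by
  have hcl : IsClosed (⋃ ν ∈ admissibleIndex n B, Box.Icc (box n ν)) :=
    isClosed_biUnion_finset fun ν _ => isClosed_Icc
  have hsub : (B : Set (ι → ℝ)) ⊆ ⋃ ν ∈ admissibleIndex n B, Box.Icc (box n ν) := fun x hx =>
    mem_biUnion (mem_admissibleIndex_of_mem_box n hB hx)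
      (Box.coe_subset_Icc (mem_box_iff_index.2 rfl))
  have h := closure_minimal hsub hcl
  rw [Box.coe_eq_pi, closure_pi_set] at h
  rw [Box.Icc_eq_pi]
  simpa only [closure_Ioc (B.lower_lt_upper _).ne] using! h

/-- A Riemann-integrable function is bounded. -/
theorem exists_abs_le_of_riemann {B : Box ι} (hB : hasIntegralVertices B) {F : (ι → ℝ) → ℝ}
    (hF : Integrable B IntegrationParams.Riemann F
      (BoxAdditiveMap.volume : BoxAdditiveMap ι (ℝ →L[ℝ] ℝ) ⊤)) :
    ∃ C, ∀ x ∈ Box.Icc B, |F x| ≤ C := by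
  classical
  obtain ⟨n, _, H⟩ := exists_abs_sum_sub_le hB hF one_pos
  have htag : ∀ ν : ι → ℤ, tag n ν ∈ Box.Icc (box n ν) := fun ν => Box.coe_subset_Icc (tag_mem n ν)
  -- Moving the tag of a single cube leaves one nonzero term in the difference of the two Riemann
  -- sums, so `F` varies boundedly on that cube.
  have key : ∀ ν ∈ admissibleIndex n B, ∀ x ∈ Box.Icc (box n ν),
      |F x - F (tag n ν)| ≤ (n : ℝ) ^ Fintype.card ι := by
    intro ν hν x hx
    have hmem : ∀ μ ∈ admissibleIndex n B,
        Function.update (fun μ => tag n μ) ν x μ ∈ Box.Icc (box n μ) := by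
      intro μ _
      rcases eq_or_ne μ ν with rfl | h
      · simpa using hx
      · simpa [h] using htag μ
    have h1 := H _ _ hmem fun μ _ => htag μ
    have h2 := H _ _ (fun μ _ => htag μ) hmem
    rw [Finset.sum_eq_single_of_mem ν hν (fun μ _ h => by simp [h])] at h1 h2
    simp only [Function.update_self, one_mul] at h1 h2
    exact abs_le.2 ⟨by linarith, h1⟩
  refine ⟨∑ ν ∈ admissibleIndex n B, |F (tag n ν)| + (n : ℝ) ^ Fintype.card ι, fun x hx => ?_⟩
  obtain ⟨ν, hν, hx⟩ := mem_iUnion₂.1 (Icc_subset_iUnion_box hB n hx)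
  have h1 := key ν hν x hx
  have h2 := Finset.single_le_sum (f := fun ν => |F (tag n ν)|) (fun _ _ => abs_nonneg _) hν
  have h3 := abs_sub_abs_le_abs_sub (F x) (F (tag n ν))
  linarith

/-- The set of points of `B` around which `F` oscillates by more than `a` is null. -/
theorem measure_oscillation_eq_zero {B : Box ι} (hB : hasIntegralVertices B) {F : (ι → ℝ) → ℝ}
    (hF : Integrable B IntegrationParams.Riemann F
      (BoxAdditiveMap.volume : BoxAdditiveMap ι (ℝ →L[ℝ] ℝ) ⊤)) {a : ℝ} (ha : 0 < a) :
    volume {x ∈ Box.Icc B | ∀ U, IsOpen U → x ∈ U → ∃ y ∈ U, ∃ z ∈ U, a < F y - F z} = 0 := by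
  classical
  set D := {x ∈ Box.Icc B | ∀ U, IsOpen U → x ∈ U → ∃ y ∈ U, ∃ z ∈ U, a < F y - F z} with hD
  refine le_antisymm (le_of_forall_pos_le_add fun ε' hε' => ?_) zero_le
  rw [zero_add]
  obtain ⟨ε, hε0, hεε'⟩ : ∃ ε : ℝ, 0 < ε ∧ ENNReal.ofReal ε ≤ ε' := by
    rcases eq_or_ne ε' ⊤ with rfl | h
    · exact ⟨1, one_pos, le_top⟩
    · exact ⟨ε'.toReal, ENNReal.toReal_pos hε'.ne' h, by rw [ENNReal.ofReal_toReal h]⟩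
  -- With tolerance `a * ε`, and each bad cube contributing at least `a` for suitable tags, the bad
  -- cubes have total volume at most `ε`.
  obtain ⟨n, _, H⟩ := exists_abs_sum_sub_le hB hF (mul_pos ha hε0)
  set bad := (admissibleIndex n B).filter fun ν =>
    ∃ y ∈ Box.Icc (box n ν), ∃ z ∈ Box.Icc (box n ν), a < F y - F z with hbad
  -- Faces of cubes are null, so almost every point of `D` is interior to its cube, and that
  -- interior serves as the open set `U`.
  have hcover : ∀ᵐ x, x ∈ D → x ∈ ⋃ ν ∈ bad, (box n ν : Set (ι → ℝ)) := by
    have h1 : ∀ᵐ x : ι → ℝ, x ∈ (B : Set (ι → ℝ)) ↔ x ∈ Box.Icc B :=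
      (Box.coe_ae_eq_Icc B).mono fun x hx => iff_of_eq hx
    have h2 : ∀ᵐ x : ι → ℝ, ∀ ν : ι → ℤ, x ∈ Box.Ioo (box n ν) ↔ x ∈ Box.Icc (box n ν) :=
      ae_all_iff.2 fun ν => (Box.Ioo_ae_eq_Icc (box n ν)).mono fun x hx => iff_of_eq hx
    filter_upwards [h1, h2] with x hx1 hx2 hxD
    have hxbox : x ∈ box n (index n x) := mem_box_iff_index.2 rfl
    refine mem_biUnion (Finset.mem_filter.2 ⟨mem_admissibleIndex_of_mem_box n hB (hx1.2 hxD.1), ?_⟩)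
      hxbox
    obtain ⟨y, hy, z, hz, h⟩ := hxD.2 _ (isOpen_set_pi finite_univ fun _ _ => isOpen_Ioo)
      ((hx2 _).2 (Box.coe_subset_Icc hxbox))
    exact ⟨y, Box.Ioo_subset_Icc _ hy, z, Box.Ioo_subset_Icc _ hz, h⟩
  have hcard : (bad.card : ℝ) ≤ ε * (n : ℝ) ^ Fintype.card ι := by
    have hch : ∀ ν : ι → ℤ, ∃ y z, y ∈ Box.Icc (box n ν) ∧ z ∈ Box.Icc (box n ν) ∧
        (if ν ∈ bad then a else 0) ≤ F y - F z := by
      intro ν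
      split_ifs with h
      · obtain ⟨y, hy, z, hz, h⟩ := (Finset.mem_filter.1 h).2
        exact ⟨y, z, hy, hz, h.le⟩
      · have := Box.coe_subset_Icc (tag_mem n ν)
        exact ⟨_, _, this, this, by simp⟩
    choose s t hs ht hst using hch
    have h := (Finset.sum_le_sum fun ν _ => hst ν).trans (H s t (fun ν _ => hs ν) fun ν _ => ht ν)
    rw [← Finset.sum_filter, Finset.filter_mem_eq_inter,
      Finset.inter_eq_right.2 (Finset.filter_subset _ _), Finset.sum_const, nsmul_eq_mul] at h
    refine le_of_mul_le_mul_left ?_ ha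
    linarith
  have hn : (0 : ℝ) < (n : ℝ) ^ Fintype.card ι := by
    have : 0 < n := Nat.pos_of_ne_zero (NeZero.ne n)
    positivity
  calc volume D ≤ volume (⋃ ν ∈ bad, (box n ν : Set (ι → ℝ))) := measure_mono_ae hcover
    _ ≤ ∑ ν ∈ bad, volume (box n ν : Set (ι → ℝ)) := measure_biUnion_finset_le _ _
    _ = ENNReal.ofReal (bad.card / (n : ℝ) ^ Fintype.card ι) := by
        simp only [volume_box, Finset.sum_const, nsmul_eq_mul]
        rw [ENNReal.ofReal_div_of_pos hn, ENNReal.ofReal_natCast,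
          ENNReal.ofReal_pow (Nat.cast_nonneg n), ENNReal.ofReal_natCast, mul_one_div]
    _ ≤ ENNReal.ofReal ε := ENNReal.ofReal_le_ofReal ((div_le_iff₀ hn).2 hcard)
    _ ≤ ε' := hεε'

/-- A Riemann-integrable function is continuous almost everywhere. -/
theorem ae_continuousAt_of_riemann {B : Box ι} (hB : hasIntegralVertices B) {F : (ι → ℝ) → ℝ}
    (hF : Integrable B IntegrationParams.Riemann F
      (BoxAdditiveMap.volume : BoxAdditiveMap ι (ℝ →L[ℝ] ℝ) ⊤)) :
    ∀ᵐ x, x ∈ Box.Icc B → ContinuousAt F x := by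
  have h : ∀ᵐ x, ∀ j : ℕ, ¬(x ∈ Box.Icc B ∧ ∀ U, IsOpen U → x ∈ U →
      ∃ y ∈ U, ∃ z ∈ U, 1 / ((j : ℝ) + 1) < F y - F z) := ae_all_iff.2 fun j => by
    rw [ae_iff]
    simpa only [not_not] using!
      measure_oscillation_eq_zero hB hF (Nat.one_div_pos_of_nat (α := ℝ) (n := j))
  filter_upwards [h] with x hx hxB
  rw [Metric.continuousAt_iff']
  intro ε hε
  obtain ⟨j, hj⟩ := exists_nat_one_div_lt hε
  have := hx j
  push Not at this
  obtain ⟨U, hU, hxU, hosc⟩ := this hxB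
  filter_upwards [hU.mem_nhds hxU] with y hy
  rw [Real.dist_eq]
  have h1 := hosc y hy x hxU
  have h2 := hosc x hxU y hy
  exact (abs_le.2 ⟨by linarith, h1⟩).trans_lt hj

end LebesgueCriterion

theorem hasIntegralVertices_unitSquare : BoxIntegral.hasIntegralVertices unitSquare :=
  ⟨fun _ => 0, fun _ => 1, fun _ => by simp [unitSquare], fun _ => by simp [unitSquare]⟩

theorem mem_Icc_unitSquare {x : Fin 2 → ℝ} :
    x ∈ BoxIntegral.Box.Icc unitSquare ↔ x 0 ∈ Icc (0 : ℝ) 1 ∧ x 1 ∈ Icc (0 : ℝ) 1 := by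
  rw [BoxIntegral.Box.Icc_eq_pi]
  simp only [unitSquare, Set.mem_pi, mem_univ, true_imp_iff, Fin.forall_fin_two]

theorem RiemannIntegrable.exists_le {f : ℝ → ℝ → ℝ} (hf : RiemannIntegrable f) :
    ∃ C : ℝ, 1 ≤ C ∧ ∀ x ∈ Icc (0 : ℝ) 1, ∀ y ∈ Icc (0 : ℝ) 1, f x y ≤ C := by
  obtain ⟨C, hC⟩ := exists_abs_le_of_riemann hasIntegralVertices_unitSquare hf
  refine ⟨max C 1, le_max_right _ _, fun x hx y hy => le_max_of_le_left ?_⟩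
  have := hC ![x, y] (mem_Icc_unitSquare.2 ⟨by simpa using hx, by simpa using hy⟩)
  exact (le_abs_self _).trans (by simpa using this)

theorem RiemannIntegrable.ae_continuousAt {f : ℝ → ℝ → ℝ} (hf : RiemannIntegrable f) :
    ∀ᵐ x : Fin 2 → ℝ, x 0 ∈ Icc (0 : ℝ) 1 → x 1 ∈ Icc (0 : ℝ) 1 →
      ContinuousAt (fun x : Fin 2 → ℝ => f (x 0) (x 1)) x := by
  filter_upwards [ae_continuousAt_of_riemann hasIntegralVertices_unitSquare hf] with x hx h0 h1
  exact hx (mem_Icc_unitSquare.2 ⟨h0, h1⟩)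

/-! ### Correlation inequalities for products of Bernoulli measures -/

section Percolation

variable {E α : Type*}

/-- The event that all the coordinates in `S` are `true`. -/
def allTrue (S : Finset E) : Set (E → Bool) := {ω | ∀ e ∈ S, ω e = true}

/-- The event that none of the families `A i`, `i ∈ I`, is entirely `true`. -/
def noneTrue (A : α → Finset E) (I : Finset α) : Set (E → Bool) :=
  {ω | ∀ i ∈ I, ω ∉ allTrue (A i)}

theorem isUpperSet_allTrue (S : Finset E) : IsUpperSet (allTrue S) := by
  intro ω ω' h hω e he
  have := h e
  rw [hω e he] at this
  exact top_le_iff.1 this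

theorem isLowerSet_noneTrue (A : α → Finset E) (I : Finset α) :
    IsLowerSet (noneTrue A I) := fun _ _ h hω i hi h' =>
  hω i hi (isUpperSet_allTrue _ h h')

theorem noneTrue_insert [DecidableEq α] (A : α → Finset E) (i : α) (I : Finset α) :
    noneTrue A (insert i I) = (allTrue (A i))ᶜ ∩ noneTrue A I := by
  ext ω
  simp [noneTrue]

theorem allTrue_union [DecidableEq E] (S T : Finset E) : allTrue (S ∪ T) = allTrue S ∩ allTrue T := by
  ext ω
  simp only [allTrue, Finset.mem_union, Set.mem_ofPred_eq, Set.mem_inter_iff]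
  exact ⟨fun h => ⟨fun e he => h e (.inl he), fun e he => h e (.inr he)⟩,
    fun h e he => he.elim (h.1 e) (h.2 e)⟩

variable [Fintype E]

/-- The product of Bernoulli measures: the coordinate `e` is `true` with probability `q e`. -/
noncomputable def bernoulliProduct (q : E → unitInterval) : Measure (E → Bool) :=
  Measure.pi fun e => ProbabilityTheory.bernoulliMeasure true false (q e)

instance (q : E → unitInterval) : IsProbabilityMeasure (bernoulliProduct q) := by
  unfold bernoulliProduct; infer_instance

variable (q : E → unitInterval)

theorem bernoulliProduct_real_pi (s : E → Set Bool) :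
    (bernoulliProduct q).real (Set.pi univ s) =
      ∏ e, (ProbabilityTheory.bernoulliMeasure true false (q e)).real (s e) := by
  simp only [measureReal_def, bernoulliProduct, Measure.pi_pi, ENNReal.toReal_prod]

theorem bernoulliProduct_real_allTrue (S : Finset E) :
    (bernoulliProduct q).real (allTrue S) = ∏ e ∈ S, (q e : ℝ) := by
  classical
  have h : allTrue S = Set.pi univ fun e => if e ∈ S then {true} else univ := by
    ext ω
    simp only [allTrue, Set.mem_ofPred_eq, Set.mem_pi, mem_univ, true_imp_iff]
    refine forall_congr' fun e => ?_
    split_ifs with he <;> simp [he]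
  rw [h, bernoulliProduct_real_pi, ← Finset.prod_subset (Finset.subset_univ S)]
  · refine Finset.prod_congr rfl fun e he => ?_
    rw [if_pos he, ProbabilityTheory.bernoulliMeasure_real_apply _ (measurableSet_singleton _)]
    simp
  · intro e _ he
    rw [if_neg he, probReal_univ]

/-- In each coordinate, the meet and join are the two original values, possibly swapped. This is the
lattice condition of the FKG inequality, with equality. -/
theorem bernoulliProduct_real_singleton_mul (ω η : E → Bool) :
    (bernoulliProduct q).real {ω} * (bernoulliProduct q).real {η} =
      (bernoulliProduct q).real {ω ⊓ η} * (bernoulliProduct q).real {ω ⊔ η} := by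
  simp only [← Set.univ_pi_singleton, bernoulliProduct_real_pi, ← Finset.prod_mul_distrib]
  refine Finset.prod_congr rfl fun e _ => ?_
  rcases le_total (ω e) (η e) with h | h
  · simp [h]
  · simp [h, mul_comm]

/-- **Harris' inequality** for increasing events. -/
theorem harris_upper {A B : Set (E → Bool)} (hA : IsUpperSet A) (hB : IsUpperSet B) :
    (bernoulliProduct q).real A * (bernoulliProduct q).real B ≤
      (bernoulliProduct q).real (A ∩ B) := by
  classical
  have hsum : ∀ C : Set (E → Bool), (bernoulliProduct q).real C =
      ∑ ω, (bernoulliProduct q).real {ω} * C.indicator 1 ω := by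
    intro C
    have h := sum_measureReal_singleton (μ := bernoulliProduct q) (Finset.univ.filter (· ∈ C))
    rw [Finset.coe_filter_univ] at h
    have h' : {x | x ∈ C} = C := rfl
    rw [h'] at h
    rw [← h, Finset.sum_filter]
    exact Finset.sum_congr rfl fun ω _ => by by_cases hω : ω ∈ C <;> simp [hω]
  have hmono : ∀ C : Set (E → Bool), IsUpperSet C → Monotone (C.indicator (1 : (E → Bool) → ℝ)) := by
    intro C hC ω η h
    by_cases hω : ω ∈ C
    · simp [hω, hC h hω]
    · rw [Set.indicator_of_notMem hω]
      exact Set.indicator_nonneg (fun _ _ => zero_le_one) η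
  have h := fkg (A.indicator (1 : (E → Bool) → ℝ)) (B.indicator 1)
    (fun ω => (bernoulliProduct q).real {ω}) (fun _ => measureReal_nonneg)
    (fun ω => Set.indicator_nonneg (fun _ _ => zero_le_one) ω)
    (fun ω => Set.indicator_nonneg (fun _ _ => zero_le_one) ω) (hmono A hA) (hmono B hB)
    (fun ω η => (bernoulliProduct_real_singleton_mul q ω η).le)
  have h1 : ∑ ω, (bernoulliProduct q).real {ω} = 1 := by
    simp
  rw [h1, one_mul, ← hsum, ← hsum] at h
  refine h.trans_eq ?_
  rw [hsum]
  exact Finset.sum_congr rfl fun ω _ => by rw [Set.inter_indicator_one]; rfl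

theorem harris_upper_lower {A D : Set (E → Bool)} (hA : IsUpperSet A) (hD : IsLowerSet D) :
    (bernoulliProduct q).real (A ∩ D) ≤
      (bernoulliProduct q).real A * (bernoulliProduct q).real D := by
  have h := harris_upper q hA hD.compl
  have hDm : MeasurableSet D := D.toFinite.measurableSet
  rw [probReal_compl_eq_one_sub hDm] at h
  have h' := measureReal_inter_add_sdiff (μ := bernoulliProduct q) (s := A) hDm
  rw [Set.sdiff_eq] at h'
  linarith

theorem harris_lower {C D : Set (E → Bool)} (hC : IsLowerSet C) (hD : IsLowerSet D) :
    (bernoulliProduct q).real C * (bernoulliProduct q).real D ≤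
      (bernoulliProduct q).real (C ∩ D) := by
  have h := harris_upper_lower q hC.compl hD
  have hCm : MeasurableSet C := C.toFinite.measurableSet
  rw [probReal_compl_eq_one_sub hCm] at h
  have h' := measureReal_inter_add_sdiff (μ := bernoulliProduct q) (s := D) hCm
  rw [Set.sdiff_eq, Set.inter_comm D, Set.inter_comm D] at h'
  linarith

/-- The hypothesis says that `D` is determined by the coordinates outside `S`; it is then a preimage
under restriction to `Sᶜ`, which is independent of restriction to `S`. -/
theorem bernoulliProduct_real_allTrue_inter {S : Finset E} {D : Set (E → Bool)}
    (hD : ∀ ω η : E → Bool, (∀ e ∉ S, ω e = η e) → ω ∈ D → η ∈ D) :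
    (bernoulliProduct q).real (allTrue S ∩ D) =
      (bernoulliProduct q).real (allTrue S) * (bernoulliProduct q).real D := by
  classical
  have hind : ProbabilityTheory.iIndepFun (fun (e : E) (ω : E → Bool) => ω e)
      (bernoulliProduct q) :=
    ProbabilityTheory.iIndepFun_pi (X := fun _ => id) fun _ => aemeasurable_id
  have h := hind.indepFun_finset S Sᶜ disjoint_compl_right fun e => measurable_pi_apply e
  have h1 : allTrue S = (fun (ω : E → Bool) (e : S) => ω e) ⁻¹' {x | ∀ e, x e = true} := by
    ext ω; simp [allTrue]
  have h2 : D = (fun (ω : E → Bool) (e : (Sᶜ : Finset E)) => ω e) ⁻¹'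
      ((fun (ω : E → Bool) (e : (Sᶜ : Finset E)) => ω e) '' D) := by
    refine (Set.subset_preimage_image _ _).antisymm ?_
    rintro η ⟨ω, hω, h⟩
    exact hD ω η (fun e he => congrFun h ⟨e, Finset.mem_compl.2 he⟩) hω
  have h3 := h.measure_inter_preimage_eq_mul {x | ∀ e, x e = true}
    ((fun (ω : E → Bool) (e : (Sᶜ : Finset E)) => ω e) '' D)
    (Set.toFinite _).measurableSet (Set.toFinite _).measurableSet
  rw [← h1, ← h2] at h3
  rw [measureReal_def, h3, ENNReal.toReal_mul]
  rfl

variable [DecidableEq α] (A : α → Finset E)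

/-- The events avoided are increasing, so their complements are positively correlated by Harris'
inequality. -/
theorem prod_one_sub_le_noneTrue (I : Finset α) :
    ∏ i ∈ I, (1 - (bernoulliProduct q).real (allTrue (A i))) ≤
      (bernoulliProduct q).real (noneTrue A I) := by
  induction I using Finset.induction_on with
  | empty => simp [noneTrue]
  | insert i I hi ih =>
    rw [Finset.prod_insert hi, noneTrue_insert]
    have h := harris_lower q (isUpperSet_allTrue (A i)).compl (isLowerSet_noneTrue A I)
    rw [probReal_compl_eq_one_sub (Set.toFinite _).measurableSet] at h
    exact (mul_le_mul_of_nonneg_left ih (sub_nonneg.2 measureReal_le_one)).trans h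

variable [DecidableEq E]

/-- The total probability of the pairs of distinct intersecting families `A i`, `A j`. -/
noncomputable def overlap (I : Finset α) : ℝ :=
  ∑ i ∈ I, ∑ j ∈ I with j ≠ i ∧ ¬Disjoint (A j) (A i),
    (bernoulliProduct q).real (allTrue (A i ∪ A j))

/-- One step of Janson's inequality. The families disjoint from `A i` are independent of it. Each
overlapping family lowers the conditional probability of `allTrue (A i)` by at most the joint
probability of the two families, by Harris' inequality. Finally `1 - x ≤ exp (-x)`. -/
theorem noneTrue_insert_le {i : α} {I : Finset α} :
    (bernoulliProduct q).real (noneTrue A (insert i I)) ≤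
      (bernoulliProduct q).real (noneTrue A I) *
        Real.exp (-((bernoulliProduct q).real (allTrue (A i)) -
          ∑ j ∈ I with ¬Disjoint (A j) (A i), (bernoulliProduct q).real (allTrue (A i ∪ A j)))) := by
  set P := bernoulliProduct q
  set σ := ∑ j ∈ I with ¬Disjoint (A j) (A i), P.real (allTrue (A i ∪ A j)) with hσ
  set J := I.filter fun j => Disjoint (A j) (A i) with hJ
  set K := I.filter fun j => ¬Disjoint (A j) (A i) with hK
  have hm : ∀ C : Set (E → Bool), MeasurableSet C := fun C => C.toFinite.measurableSet
  have hsplit : noneTrue A I = noneTrue A J ∩ noneTrue A K := by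
    ext ω
    simp only [noneTrue, hJ, hK, Finset.mem_filter, Set.mem_ofPred_eq, Set.mem_inter_iff]
    refine ⟨fun h => ⟨fun j hj => h j hj.1, fun j hj => h j hj.1⟩, fun h j hj => ?_⟩
    by_cases hd : Disjoint (A j) (A i)
    exacts [h.1 j ⟨hj, hd⟩, h.2 j ⟨hj, hd⟩]
  have hle : P.real (noneTrue A I) ≤ P.real (noneTrue A J) :=
    measureReal_mono (hsplit.le.trans inter_subset_left)
  have hindep : P.real (allTrue (A i) ∩ noneTrue A J) =
      P.real (allTrue (A i)) * P.real (noneTrue A J) := by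
    refine bernoulliProduct_real_allTrue_inter q fun ω η h hω j hj h' => hω j hj fun e he => ?_
    rw [h e (Finset.disjoint_left.1 (Finset.mem_filter.1 hj).2 he)]
    exact h' e he
  have hcover : allTrue (A i) ∩ noneTrue A J ⊆
      (allTrue (A i) ∩ noneTrue A I) ∪ ⋃ j ∈ K, (allTrue (A i ∪ A j) ∩ noneTrue A J) := by
    rintro ω ⟨h1, h2⟩
    by_cases h : ω ∈ noneTrue A K
    · exact .inl ⟨h1, hsplit ▸ ⟨h2, h⟩⟩
    · simp only [noneTrue, Set.mem_ofPred_eq, not_forall, not_not] at h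
      obtain ⟨j, hj, h⟩ := h
      exact .inr (mem_biUnion hj ⟨allTrue_union (A i) (A j) ▸ ⟨h1, h⟩, h2⟩)
  have hsum : P.real (allTrue (A i) ∩ noneTrue A J) ≤
      P.real (allTrue (A i) ∩ noneTrue A I) + σ * P.real (noneTrue A J) := by
    refine (measureReal_mono hcover).trans ((measureReal_union_le _ _).trans ?_)
    gcongr
    refine (measureReal_biUnion_finset_le _ _).trans ?_
    rw [hσ, Finset.sum_mul]
    exact Finset.sum_le_sum fun j _ =>
      harris_upper_lower q (isUpperSet_allTrue _) (isLowerSet_noneTrue A J)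
  have hkey : (P.real (allTrue (A i)) - σ) * P.real (noneTrue A I) ≤
      P.real (allTrue (A i) ∩ noneTrue A I) := by
    rcases le_total 0 (P.real (allTrue (A i)) - σ) with h | h
    · refine (mul_le_mul_of_nonneg_left hle h).trans ?_
      rw [hindep] at hsum
      linarith
    · exact (mul_nonpos_of_nonpos_of_nonneg h measureReal_nonneg).trans measureReal_nonneg
  have hdiff := measureReal_inter_add_sdiff (μ := P) (s := noneTrue A I) (hm (allTrue (A i)))
  rw [noneTrue_insert, Set.inter_comm, ← Set.sdiff_eq]
  rw [Set.inter_comm] at hdiff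
  calc P.real (noneTrue A I \ allTrue (A i))
      ≤ P.real (noneTrue A I) * (-(P.real (allTrue (A i)) - σ) + 1) := by linarith
    _ ≤ _ := mul_le_mul_of_nonneg_left (Real.add_one_le_exp _) measureReal_nonneg

/-- **Janson's inequality** (with a non-optimal constant). -/
theorem janson (I : Finset α) :
    (bernoulliProduct q).real (noneTrue A I) ≤
      Real.exp (-∑ i ∈ I, (bernoulliProduct q).real (allTrue (A i)) + overlap q A I) := by
  induction I using Finset.induction_on with
  | empty => simp [noneTrue, overlap]
  | insert i I hi ih =>
    refine (noneTrue_insert_le q A).trans ?_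
    refine (mul_le_mul_of_nonneg_right ih (Real.exp_pos _).le).trans ?_
    rw [← Real.exp_add, Finset.sum_insert hi]
    refine Real.exp_le_exp.2 ?_
    -- `overlap` runs over ordered pairs, so inserting `i` adds the required sum as its new row; the
    -- new column is discarded.
    have h : overlap q A I + ∑ j ∈ I with ¬Disjoint (A j) (A i),
        (bernoulliProduct q).real (allTrue (A i ∪ A j)) ≤ overlap q A (insert i I) := by
      rw [overlap, overlap, Finset.sum_insert hi, add_comm]
      refine add_le_add (Finset.sum_le_sum_of_subset_of_nonneg ?_ fun _ _ _ => measureReal_nonneg)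
        (Finset.sum_le_sum fun j _ => Finset.sum_le_sum_of_subset_of_nonneg
          (Finset.filter_subset_filter _ (Finset.subset_insert _ _))
          fun _ _ _ => measureReal_nonneg)
      intro j hj
      rw [Finset.mem_filter] at hj ⊢
      exact ⟨Finset.mem_insert_of_mem hj.1, fun h => hi (h ▸ hj.1), hj.2⟩
    linarith

/-- The second moment bound for the probability that none of the families is entirely `true`. -/
theorem noneTrue_mul_sq_le (I : Finset α) :
    (bernoulliProduct q).real (noneTrue A I) *
        (∑ i ∈ I, (bernoulliProduct q).real (allTrue (A i))) ^ 2 ≤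
      ∑ i ∈ I, (bernoulliProduct q).real (allTrue (A i)) + overlap q A I := by
  set P := bernoulliProduct q
  set m := ∑ i ∈ I, P.real (allTrue (A i)) with hm
  have hmeas : ∀ C : Set (E → Bool), MeasurableSet C := fun C => C.toFinite.measurableSet
  have hint : ∀ g : (E → Bool) → ℝ, Integrable g P := fun g => Integrable.of_finite
  set X : (E → Bool) → ℝ := fun ω => ∑ i ∈ I, (allTrue (A i)).indicator 1 ω with hX
  have hX1 : ∫ ω, X ω ∂P = m := by
    rw [hX, integral_finsetSum _ fun i _ => hint _]
    exact Finset.sum_congr rfl fun i _ => integral_indicator_one (hmeas _)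
  have hX2 : ∫ ω, X ω ^ 2 ∂P = ∑ i ∈ I, ∑ j ∈ I, P.real (allTrue (A i ∪ A j)) := by
    have : ∀ ω, X ω ^ 2 = ∑ i ∈ I, ∑ j ∈ I, (allTrue (A i ∪ A j)).indicator 1 ω := by
      intro ω
      rw [sq, hX, Finset.sum_mul_sum]
      refine Finset.sum_congr rfl fun i _ => Finset.sum_congr rfl fun j _ => ?_
      rw [allTrue_union, Set.inter_indicator_one]
      rfl
    simp_rw [this]
    rw [integral_finsetSum _ fun i _ => hint _]
    refine Finset.sum_congr rfl fun i _ => ?_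
    rw [integral_finsetSum _ fun i _ => hint _]
    exact Finset.sum_congr rfl fun j _ => integral_indicator_one (hmeas _)
  have hvar : ∫ ω, (X ω - m) ^ 2 ∂P =
      ∑ i ∈ I, ∑ j ∈ I, P.real (allTrue (A i ∪ A j)) - m ^ 2 := by
    have : ∀ ω, (X ω - m) ^ 2 = X ω ^ 2 - 2 * m * X ω + m ^ 2 := fun ω => by ring
    simp_rw [this]
    rw [integral_add (hint _) (hint _), integral_sub (hint _) (hint _), integral_const_mul,
      hX1, hX2, integral_const, probReal_univ, one_smul]
    ring
  -- Chebyshev's argument: the count `X` vanishes on `noneTrue A I`, so the squared deviation there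
  -- equals `m ^ 2`.
  have hlow : P.real (noneTrue A I) * m ^ 2 ≤ ∫ ω, (X ω - m) ^ 2 ∂P := by
    rw [← integral_indicator_one (hmeas _), ← integral_mul_const]
    refine integral_mono (hint _) (hint _) fun ω => ?_
    by_cases hω : ω ∈ noneTrue A I
    · have : X ω = 0 := Finset.sum_eq_zero fun i hi => Set.indicator_of_notMem (hω i hi) _
      simp [hω, this]
    · simpa [hω] using sq_nonneg (X ω - m)
  refine hlow.trans ?_
  rw [hvar, hm, sq, Finset.sum_mul_sum, ← Finset.sum_sub_distrib, overlap,
    ← Finset.sum_add_distrib]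
  refine Finset.sum_le_sum fun i hi => ?_
  rw [← Finset.sum_sub_distrib]
  -- Covariances: disjoint families contribute zero, while the diagonal and the overlapping pairs
  -- are bounded by dropping the product.
  have hterm : ∀ j ∈ I, P.real (allTrue (A i ∪ A j)) - P.real (allTrue (A i)) * P.real (allTrue (A j))
      ≤ (if j = i then P.real (allTrue (A i)) else 0) +
        if j ≠ i ∧ ¬Disjoint (A j) (A i) then P.real (allTrue (A i ∪ A j)) else 0 := by
    intro j _
    have hnn : 0 ≤ P.real (allTrue (A i)) * P.real (allTrue (A j)) :=
      mul_nonneg measureReal_nonneg measureReal_nonneg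
    by_cases hij : j = i
    · subst hij
      simpa using hnn
    · by_cases hd : Disjoint (A j) (A i)
      · have : P.real (allTrue (A i ∪ A j)) = P.real (allTrue (A i)) * P.real (allTrue (A j)) := by
          simp only [P, bernoulliProduct_real_allTrue, Finset.prod_union hd.symm]
        simp [hij, hd, this]
      · simpa [hij, hd] using hnn
  refine (Finset.sum_le_sum hterm).trans_eq ?_
  rw [Finset.sum_add_distrib, Finset.sum_ite_eq' I i, if_pos hi, Finset.sum_filter]

end Percolation

/-! ### Paths, shared edges and the overlap bound -/

section Paths

/-- The vertices `1, w_1, …, w_m, n`. -/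
def nodes (n : ℕ) {m : ℕ} (w : Fin m → ℕ) : Fin (m + 2) → ℕ :=
  Fin.cons (α := fun _ => ℕ) 1 (Fin.snoc (α := fun _ => ℕ) w n)

@[simp] theorem nodes_zero (n : ℕ) {m : ℕ} (w : Fin m → ℕ) : nodes n w 0 = 1 := rfl

@[simp] theorem nodes_last (n : ℕ) {m : ℕ} (w : Fin m → ℕ) :
    nodes n w (Fin.last (m + 1)) = n := by
  rw [nodes, ← Fin.succ_last, Fin.cons_succ, Fin.snoc_last]

@[simp] theorem nodes_castSucc_succ (n : ℕ) {m : ℕ} (w : Fin m → ℕ) (i : Fin m) :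
    nodes n w i.succ.castSucc = w i := by
  rw [nodes, ← Fin.succ_castSucc, Fin.cons_succ, Fin.snoc_castSucc]

theorem fin_cases_ends {m : ℕ} {p : Fin (m + 2) → Prop} (h0 : p 0) (hl : p (Fin.last (m + 1)))
    (h : ∀ i : Fin m, p i.succ.castSucc) (i : Fin (m + 2)) : p i := by
  induction i using Fin.lastCases with
  | last => exact hl
  | cast i =>
    induction i using Fin.cases with
    | zero => exact h0
    | succ i => exact h i

/-- The vertices of the path through `v_1 + 1, …, v_m + 1`. -/
def route {n m : ℕ} (v : Fin m → Fin n) : Fin (m + 2) → ℕ := nodes n fun j => (v j : ℕ) + 1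

/-- The increasing paths from `1` to `n` with `m` intermediate vertices. -/
def paths (n m : ℕ) : Finset (Fin m → Fin n) := Finset.univ.filter fun v => StrictMono (route v)

variable {n m : ℕ}

theorem mem_paths {v : Fin m → Fin n} : v ∈ paths n m ↔ StrictMono (route v) := by
  simp [paths]

/-- The set of edges of a path. -/
def pathEdges (v : Fin m → Fin n) : Finset (Edge n) := Finset.univ.filter fun e =>
  ∃ j : Fin (m + 1), (e.1.1 : ℕ) = route v j.castSucc ∧ (e.1.2 : ℕ) = route v j.succ

theorem mem_pathEdges {v : Fin m → Fin n} {e : Edge n} : e ∈ pathEdges v ↔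
    ∃ j : Fin (m + 1), (e.1.1 : ℕ) = route v j.castSucc ∧ (e.1.2 : ℕ) = route v j.succ := by
  simp [pathEdges]

theorem route_mem {v : Fin m → Fin n} (hv : StrictMono (route v)) (i : Fin (m + 2)) :
    route v i ∈ Finset.Icc 1 n := by
  have h0 := hv.monotone (Fin.zero_le i)
  have h1 := hv.monotone (Fin.le_last i)
  simp only [route, nodes_zero, nodes_last] at h0 h1
  exact Finset.mem_Icc.2 ⟨h0, h1⟩

/-- The `j`-th edge of a path. -/
def pathEdge (v : Fin m → Fin n) (hv : StrictMono (route v)) (j : Fin (m + 1)) : Edge n :=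
  ⟨(⟨route v j.castSucc, route_mem hv _⟩, ⟨route v j.succ, route_mem hv _⟩),
    hv Fin.castSucc_lt_succ⟩

theorem pathEdge_injective {v : Fin m → Fin n} (hv : StrictMono (route v)) :
    Function.Injective (pathEdge v hv) := fun i j h => by
  have : route v i.castSucc = route v j.castSucc := congrArg (fun e : Edge n => (e.1.1 : ℕ)) h
  exact Fin.castSucc_injective _ (hv.injective this)

theorem pathEdges_eq_map {v : Fin m → Fin n} (hv : StrictMono (route v)) :
    pathEdges v = Finset.univ.map ⟨pathEdge v hv, pathEdge_injective hv⟩ := by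
  ext e
  rw [mem_pathEdges, Finset.mem_map]
  refine exists_congr fun j => ?_
  simp only [Finset.mem_univ, true_and, Function.Embedding.coeFn_mk]
  exact ⟨fun h => Subtype.ext (Prod.ext (Subtype.ext h.1.symm) (Subtype.ext h.2.symm)),
    fun h => h ▸ ⟨rfl, rfl⟩⟩

theorem card_pathEdges {v : Fin m → Fin n} (hv : StrictMono (route v)) :
    (pathEdges v).card = m + 1 := by
  rw [pathEdges_eq_map hv, Finset.card_map, Finset.card_univ, Fintype.card_fin]

theorem mem_range_of_route_eq {v w : Fin m → Fin n} (hw : StrictMono (route w)) {i : Fin m} :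
    ∀ j, route w i.succ.castSucc = route v j → w i ∈ Set.range v := by
  have h0 : route w 0 < route w i.succ.castSucc := hw (by simp [Fin.lt_def])
  have h1 : route w i.succ.castSucc < route w (Fin.last _) := hw (by simp [Fin.lt_def])
  refine fin_cases_ends ?_ ?_ fun j h => ⟨j, ?_⟩
  · intro h
    simp [route] at h h0
    omega
  · intro h
    simp [route] at h h1
    omega
  · simp only [route, nodes_castSucc_succ, add_left_inj] at h
    exact (Fin.ext h).symm

theorem strictMono_of_route {v : Fin m → Fin n} (hv : StrictMono (route v)) : StrictMono v := by
  intro i j hij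
  have := hv (show i.succ.castSucc < j.succ.castSucc by simpa using hij)
  simpa only [route, nodes_castSucc_succ, add_lt_add_iff_right] using! this

/-- A strictly increasing sequence is determined by its range, and both ranges have `m` elements. -/
theorem eq_of_range_subset {v w : Fin m → Fin n} (hv : StrictMono (route v))
    (hw : StrictMono (route w)) (h : ∀ i, w i ∈ Set.range v) : w = v := by
  have hv' := strictMono_of_route hv
  have hw' := strictMono_of_route hw
  refine (StrictMono.range_inj hw' hv').1 ?_
  have hsub : Set.range w ⊆ Set.range v := Set.range_subset_iff.2 h
  refine Set.eq_of_subset_of_ncard_le hsub ?_ (Set.toFinite _)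
  rw [Set.ncard_range_of_injective hv'.injective, Set.ncard_range_of_injective hw'.injective]

/-- Two distinct paths share at least as many intermediate vertices as edges. -/
theorem card_inter_pathEdges_le {v w : Fin m → Fin n} (hv : StrictMono (route v))
    (hw : StrictMono (route w)) (hne : w ≠ v) [DecidablePred (· ∈ Set.range v)] :
    (pathEdges w ∩ pathEdges v).card ≤
      (Finset.univ.filter fun i => w i ∈ Set.range v).card := by
  -- Deleting one edge `j₀` matches the other `m` edges bijectively with the `m` intermediate
  -- vertices: an edge before `j₀` goes to its head, one after `j₀` to its tail. If the edge is
  -- shared, so is that vertex.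
  have hmem : ∀ (j₀ : Fin (m + 1)) (i : Fin m),
      pathEdge w hw (j₀.succAbove i) ∈ pathEdges v → w i ∈ Set.range v := by
    intro j₀ i h
    obtain ⟨j', h1, h2⟩ := mem_pathEdges.1 h
    simp only [pathEdge] at h1 h2
    have hcases : j₀.succAbove i = i.castSucc ∨ j₀.succAbove i = i.succ := by
      rw [Fin.succAbove]
      split_ifs <;> simp
    rcases hcases with h | h
    · rw [h, Fin.succ_castSucc] at h2
      exact mem_range_of_route_eq hw _ h2
    · rw [h] at h1
      exact mem_range_of_route_eq hw _ h1
  -- If every edge of `w` were shared, every intermediate vertex would be too, forcing `w = v`. The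
  -- deleted edge can thus be taken unshared.
  obtain ⟨j₀, hj₀⟩ : ∃ j, pathEdge w hw j ∉ pathEdges v := by
    by_contra! hall
    exact hne (eq_of_range_subset hv hw fun i => hmem (Fin.last m) i (hall _))
  refine le_trans (Finset.card_le_card ?_)
    (Finset.card_image_le (f := fun i => pathEdge w hw (j₀.succAbove i)))
  intro e he
  rw [Finset.mem_inter, pathEdges_eq_map hw, Finset.mem_map] at he
  obtain ⟨⟨j, -, rfl⟩, hev⟩ := he
  have hj : j ≠ j₀ := by
    rintro rfl
    exact hj₀ hev
  obtain ⟨i, rfl⟩ := Fin.exists_succAbove_eq hj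
  exact Finset.mem_image.2 ⟨i, Finset.mem_filter.2 ⟨Finset.mem_univ _, hmem j₀ i hev⟩, rfl⟩

theorem one_add_pow_le {x : ℝ} (hx : 0 ≤ x) {t : ℕ} (ht : 1 ≤ t) : 1 + x ^ t ≤ (1 + x) ^ t := by
  induction t, ht using Nat.le_induction with
  | base => simp
  | succ t _ ih =>
    have h := mul_le_mul_of_nonneg_right ih (by positivity : 0 ≤ 1 + x)
    rw [← pow_succ] at h
    have := pow_nonneg hx t
    rw [pow_succ x]
    nlinarith

variable (q : Edge n → unitInterval)

theorem prod_le_pow {B : ℝ} (hq : ∀ e, (q e : ℝ) ≤ B) (S : Finset (Edge n)) :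
    ∏ e ∈ S, (q e : ℝ) ≤ B ^ S.card :=
  (Finset.prod_le_prod (fun e _ => (q e).2.1) fun e _ => hq e).trans_eq (Finset.prod_const B)

theorem allTrue_pathEdges_le {B : ℝ} (hq : ∀ e, (q e : ℝ) ≤ B) {v : Fin m → Fin n}
    (hv : StrictMono (route v)) :
    (bernoulliProduct q).real (allTrue (pathEdges v)) ≤ B ^ (m + 1) := by
  rw [bernoulliProduct_real_allTrue, ← card_pathEdges hv]
  exact prod_le_pow q hq _

/-- With `s` shared edges and `t` shared vertices, `1 ≤ s ≤ t`, the probability is at most `B ^ (2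
(m + 1)) * B⁻¹ ^ s`, and `B⁻¹ ^ s ≤ B⁻¹ ^ t ≤ (1 + B⁻¹) ^ t - 1`. The last form is a product over
the coordinates of `w`, so it can be summed over all `w`. -/
theorem allTrue_union_pathEdges_le {B : ℝ} (hB : 0 < B) (hB1 : B ≤ 1) (hq : ∀ e, (q e : ℝ) ≤ B)
    {v w : Fin m → Fin n} (hv : StrictMono (route v)) (hw : StrictMono (route w)) (hne : w ≠ v)
    (hd : ¬Disjoint (pathEdges w) (pathEdges v)) [DecidablePred (· ∈ Set.range v)] :
    (bernoulliProduct q).real (allTrue (pathEdges v ∪ pathEdges w)) ≤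
      B ^ (2 * (m + 1)) * (∏ j, (if w j ∈ Set.range v then 1 + B⁻¹ else 1) - 1) := by
  set s := (pathEdges w ∩ pathEdges v).card with hs
  set t := (Finset.univ.filter fun i => w i ∈ Set.range v).card with ht
  have hst : s ≤ t := card_inter_pathEdges_le hv hw hne
  have hs1 : 1 ≤ s := Finset.card_pos.2 (by
    rwa [Finset.nonempty_iff_ne_empty, ne_eq, ← Finset.disjoint_iff_inter_eq_empty])
  have hprod : ∏ j, (if w j ∈ Set.range v then 1 + B⁻¹ else 1) = (1 + B⁻¹) ^ t := by
    rw [← Finset.prod_filter, Finset.prod_const]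
  have hcard : (pathEdges w \ pathEdges v).card + s = m + 1 := by
    rw [hs, Finset.card_sdiff_add_card_inter, card_pathEdges hw]
  have h1 : (bernoulliProduct q).real (allTrue (pathEdges v ∪ pathEdges w)) ≤
      B ^ (m + 1) * B ^ (pathEdges w \ pathEdges v).card := by
    rw [bernoulliProduct_real_allTrue, ← Finset.union_sdiff_self_eq_union,
      Finset.prod_union Finset.disjoint_sdiff, ← card_pathEdges hv]
    exact mul_le_mul (prod_le_pow q hq _)
      (prod_le_pow q hq _)
      (Finset.prod_nonneg fun e _ => (q e).2.1) (by positivity)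
  refine h1.trans ?_
  have h2 : B ^ (pathEdges w \ pathEdges v).card = B ^ (m + 1) * B⁻¹ ^ s := by
    rw [← hcard, pow_add, mul_assoc, ← mul_pow, mul_inv_cancel₀ hB.ne', one_pow, mul_one]
  rw [h2, hprod, ← mul_assoc, ← pow_add, ← two_mul]
  gcongr
  have h3 := one_add_pow_le (inv_pos.2 hB).le (hs1.trans hst)
  have h4 : B⁻¹ ^ s ≤ B⁻¹ ^ t := pow_le_pow_right₀ ((one_le_inv₀ hB).2 hB1) hst
  linarith

/-- For fixed `v`, summing the product over all tuples `w` factorizes into `m` equal sums over one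
vertex, each at most `n + m * B⁻¹`. The subtracted `n ^ m` cancels the leading term. -/
theorem overlap_pathEdges_le {B : ℝ} (hB : 0 < B) (hB1 : B ≤ 1) (hq : ∀ e, (q e : ℝ) ≤ B) :
    overlap q pathEdges (paths n m) ≤
      (n : ℝ) ^ m * (B ^ (2 * (m + 1)) * (((n : ℝ) + m * B⁻¹) ^ m - (n : ℝ) ^ m)) := by
  classical
  have hBi : 0 < B⁻¹ := inv_pos.2 hB
  have hge : ∀ v w : Fin m → Fin n,
      1 ≤ ∏ j, (if w j ∈ Set.range v then 1 + B⁻¹ else 1) := fun v w =>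
    (Finset.prod_const_one (s := Finset.univ)).symm.trans_le
      (Finset.prod_le_prod (fun _ _ => zero_le_one) fun j _ => by split_ifs <;> linarith)
  have hsum : ∀ v : Fin m → Fin n,
      ∑ w : Fin m → Fin n, ∏ j, (if w j ∈ Set.range v then 1 + B⁻¹ else 1) ≤
        ((n : ℝ) + m * B⁻¹) ^ m := by
    intro v
    have h := Finset.prod_univ_sum (fun _ : Fin m => (Finset.univ : Finset (Fin n)))
      (fun _ x => if x ∈ Set.range v then 1 + B⁻¹ else 1)
    rw [Fintype.piFinset_univ] at h
    rw [← h, Finset.prod_const, Finset.card_univ, Fintype.card_fin]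
    have h1 : ∀ x : Fin n, (if x ∈ Set.range v then 1 + B⁻¹ else 1) =
        1 + if x ∈ Set.range v then B⁻¹ else 0 := fun x => by split_ifs <;> simp
    simp_rw [h1]
    rw [Finset.sum_add_distrib, ← Finset.sum_filter, Finset.sum_const, Finset.sum_const,
      Finset.card_univ, Fintype.card_fin, nsmul_eq_mul, nsmul_eq_mul, mul_one]
    have h2 : (Finset.univ.filter fun x => x ∈ Set.range v).card ≤ m := by
      have h3 : (Finset.univ.filter fun x => x ∈ Set.range v) ⊆ Finset.univ.image v := by
        intro x hx
        obtain ⟨j, rfl⟩ := (Finset.mem_filter.1 hx).2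
        exact Finset.mem_image_of_mem _ (Finset.mem_univ _)
      simpa using (Finset.card_le_card h3).trans Finset.card_image_le
    gcongr
  calc overlap q pathEdges (paths n m)
      ≤ ∑ v ∈ paths n m, ∑ w ∈ paths n m with w ≠ v ∧ ¬Disjoint (pathEdges w) (pathEdges v),
          B ^ (2 * (m + 1)) * (∏ j, (if w j ∈ Set.range v then 1 + B⁻¹ else 1) - 1) := by
        refine Finset.sum_le_sum fun v hv => Finset.sum_le_sum fun w hw => ?_
        obtain ⟨hw, hne, hd⟩ := Finset.mem_filter.1 hw
        exact allTrue_union_pathEdges_le q hB hB1 hq (mem_paths.1 hv) (mem_paths.1 hw) hne hd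
    _ ≤ ∑ v : Fin m → Fin n, ∑ w : Fin m → Fin n,
          B ^ (2 * (m + 1)) * (∏ j, (if w j ∈ Set.range v then 1 + B⁻¹ else 1) - 1) := by
        have hnn : ∀ v w : Fin m → Fin n, 0 ≤
            B ^ (2 * (m + 1)) * (∏ j, (if w j ∈ Set.range v then 1 + B⁻¹ else 1) - 1) :=
          fun v w => mul_nonneg (by positivity) (sub_nonneg.2 (hge v w))
        refine (Finset.sum_le_sum fun v _ => Finset.sum_le_sum_of_subset_of_nonneg
          (Finset.subset_univ _) fun w _ _ => hnn v w).trans ?_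
        exact Finset.sum_le_sum_of_subset_of_nonneg (Finset.subset_univ _)
          fun v _ _ => Finset.sum_nonneg fun w _ => hnn v w
    _ ≤ ∑ _v : Fin m → Fin n,
          B ^ (2 * (m + 1)) * (((n : ℝ) + m * B⁻¹) ^ m - (n : ℝ) ^ m) := by
        refine Finset.sum_le_sum fun v _ => ?_
        rw [← Finset.mul_sum, Finset.sum_sub_distrib]
        have := hsum v
        have hc : ∑ _w : Fin m → Fin n, (1 : ℝ) = (n : ℝ) ^ m := by simp
        rw [hc]
        gcongr
    _ = _ := by simp

theorem hasPath_iff (ω : Config n) :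
    HasPath (graph ω) (m + 1) ↔ ω ∉ noneTrue pathEdges (paths n m) := by
  have hnone : ω ∉ noneTrue pathEdges (paths n m) ↔
      ∃ v ∈ paths n m, ω ∈ allTrue (pathEdges v) := by
    simp [noneTrue]
  rw [hnone]
  constructor
  · rintro ⟨ρ, h0, h1, h⟩
    have hpos : ∀ i, 1 ≤ (ρ i : ℕ) ∧ (ρ i : ℕ) ≤ n := fun i => Finset.mem_Icc.1 (ρ i).2
    -- Vertices start at `1`, elements of `Fin n` at `0`.
    let v : Fin m → Fin n := fun j => ⟨ρ j.succ.castSucc - 1, by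
      have := hpos j.succ.castSucc
      omega⟩
    have hroute : ∀ i, route v i = ρ i := by
      refine fin_cases_ends ?_ ?_ fun j => ?_
      · rw [h0]; rfl
      · rw [h1]; simp [route]
      · simp only [route, nodes_castSucc_succ, v]
        have := hpos j.succ.castSucc
        omega
    have hv : StrictMono (route v) := Fin.strictMono_iff_lt_succ.2 fun i => by
      rw [hroute, hroute]
      exact (h i).1
    refine ⟨v, mem_paths.2 hv, fun e he => ?_⟩
    obtain ⟨j, hj1, hj2⟩ := mem_pathEdges.1 he
    rw [hroute] at hj1 hj2
    obtain ⟨hlt, hω⟩ := h j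
    have : e = ⟨(ρ j.castSucc, ρ j.succ), hlt⟩ :=
      Subtype.ext (Prod.ext (Subtype.ext hj1) (Subtype.ext hj2))
    rw [this, hω]
  · rintro ⟨v, hv, hω⟩
    rw [mem_paths] at hv
    refine ⟨fun i => ⟨route v i, route_mem hv i⟩, rfl, by simp [route], fun i => ?_⟩
    refine ⟨hv Fin.castSucc_lt_succ, hω _ (mem_pathEdges.2 ⟨i, rfl, rfl⟩)⟩

/-- For `2 ≤ n` the path of length `0` is excluded, so lengths `1, …, k` correspond to `m = 0, …, k
- 1` intermediate vertices. -/
theorem shortestPath_le_iff (hn : 2 ≤ n) (ω : Config n) (k : ℕ) :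
    shortestPath (graph ω) ≤ (k : ℕ∞) ↔
      ∃ m < k, ω ∉ noneTrue pathEdges (paths n m) := by
  have h0 : ¬HasPath (graph ω) 0 := by
    rintro ⟨ρ, h0, h1, -⟩
    have : (ρ 0 : ℕ) = ρ (Fin.last 0) := rfl
    omega
  have h : shortestPath (graph ω) ≤ (k : ℕ∞) ↔ ∃ ℓ ≤ k, HasPath (graph ω) ℓ := by
    constructor
    · intro h
      by_contra! hno
      have : ((k + 1 : ℕ) : ℕ∞) ≤ shortestPath (graph ω) := by
        refine le_iInf₂ fun ℓ hℓ => ?_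
        have : ¬ℓ ≤ k := fun h' => hno ℓ h' hℓ
        exact_mod_cast Nat.lt_of_not_le this
      have := this.trans h
      rw [Nat.cast_le] at this
      omega
    · rintro ⟨ℓ, hℓ, hp⟩
      exact (iInf₂_le ℓ hp).trans (by exact_mod_cast hℓ)
  rw [h]
  constructor
  · rintro ⟨ℓ, hℓ, hp⟩
    obtain _ | m := ℓ
    · exact absurd hp h0
    · exact ⟨m, hℓ, (hasPath_iff ω).1 hp⟩
  · rintro ⟨m, hm, hp⟩
    exact ⟨m + 1, hm, (hasPath_iff ω).2 hp⟩

end Paths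

/-! ### Convergence of the Riemann sums to the path constant -/

section RiemannSums

variable {m : ℕ}

@[simp] theorem gridPoints_zero (u : Fin m → ℝ) : gridPoints u 0 = 0 := rfl

@[simp] theorem gridPoints_last (u : Fin m → ℝ) : gridPoints u (Fin.last (m + 1)) = 1 := by
  rw [gridPoints, ← Fin.succ_last, Fin.cons_succ, Fin.snoc_last]

@[simp] theorem gridPoints_castSucc_succ (u : Fin m → ℝ) (i : Fin m) :
    gridPoints u i.succ.castSucc = u i := by
  rw [gridPoints, ← Fin.succ_castSucc, Fin.cons_succ, Fin.snoc_castSucc]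

theorem gridPoints_mem_Icc {u : Fin m → ℝ} (hu : u ∈ openSimplex m) (i : Fin (m + 2)) :
    gridPoints u i ∈ Icc (0 : ℝ) 1 := by
  have h0 := StrictMono.monotone hu (Fin.zero_le i)
  have h1 := StrictMono.monotone hu (Fin.le_last i)
  rw [gridPoints_zero] at h0
  rw [gridPoints_last] at h1
  exact ⟨h0, h1⟩

theorem continuous_gridPoints (i : Fin (m + 2)) : Continuous fun u : Fin m → ℝ => gridPoints u i := by
  revert i
  refine fin_cases_ends ?_ ?_ fun i => ?_
  · exact continuous_const
  · simpa only [gridPoints_last] using continuous_const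
  · simpa only [gridPoints_castSucc_succ] using continuous_apply i

theorem isOpen_openSimplex : IsOpen (openSimplex m) := by
  have : openSimplex m = ⋂ i : Fin (m + 1), {u | gridPoints u i.castSucc < gridPoints u i.succ} := by
    ext u
    simp only [openSimplex, Set.mem_ofPred_eq, Fin.strictMono_iff_lt_succ, Set.mem_iInter]
  rw [this]
  exact isOpen_iInter_of_finite fun i =>
    isOpen_lt (continuous_gridPoints _) (continuous_gridPoints _)

theorem nonempty_openSimplex : (openSimplex m).Nonempty := by
  refine ⟨fun j => ((j : ℕ) + 1 : ℝ) / (m + 1), ?_⟩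
  have hm : (0 : ℝ) < m + 1 := by positivity
  have h : ∀ i, gridPoints (fun j : Fin m => ((j : ℕ) + 1 : ℝ) / (m + 1)) i = (i : ℕ) / (m + 1) := by
    refine fin_cases_ends ?_ ?_ fun i => ?_
    · simp
    · simp only [gridPoints_last, Fin.val_last]
      push_cast
      exact (div_self hm.ne').symm
    · rw [gridPoints_castSucc_succ]
      simp
  show StrictMono _
  intro i j hij
  rw [h, h]
  have : ((i : ℕ) : ℝ) < (j : ℕ) := by exact_mod_cast hij
  gcongr

/-- The half-open unit cube. -/
def cube (m : ℕ) : Set (Fin m → ℝ) := Set.pi univ fun _ => Ioc (0 : ℝ) 1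

theorem measurableSet_cube : MeasurableSet (cube m) := MeasurableSet.univ_pi fun _ => measurableSet_Ioc

theorem volume_cube : volume (cube m) = 1 := by
  simp [cube, volume_pi, Measure.pi_pi]

theorem openSimplex_subset_cube : openSimplex m ⊆ cube m := by
  intro u hu i _
  have h0 : gridPoints u 0 < gridPoints u i.succ.castSucc := hu (by simp [Fin.lt_def])
  have h1 := (gridPoints_mem_Icc hu i.succ.castSucc).2
  rw [gridPoints_castSucc_succ] at h0 h1
  exact ⟨h0, h1⟩

/-- The product of `f` along the rescaled nodes `x_0 / n, x_1 / n, …`. -/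
noncomputable def scaledWeight (f : ℝ → ℝ → ℝ) (n : ℕ) (x : Fin (m + 2) → ℕ) : ℝ :=
  ∏ j : Fin (m + 1), f (x j.castSucc / (n : ℝ)) (x j.succ / (n : ℝ))

/-- The Riemann sum approximating `pathConst`. -/
noncomputable def pathSum (f : ℝ → ℝ → ℝ) (m n : ℕ) : ℝ :=
  (∑ v ∈ paths n m, scaledWeight f n (route v)) / (n : ℝ) ^ m

/-- The nodes of the `n`-grid just above the coordinates of `u`. -/
noncomputable def ceilNodes (n : ℕ) (u : Fin m → ℝ) : Fin (m + 2) → ℕ :=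
  nodes n fun j => ⌈(n : ℝ) * u j⌉₊

open scoped Classical in
/-- The step function whose integral is `pathSum`. -/
noncomputable def stepWeight (f : ℝ → ℝ → ℝ) (n : ℕ) (u : Fin m → ℝ) : ℝ :=
  if StrictMono (ceilNodes n u) then scaledWeight f n (ceilNodes n u) else 0

theorem measurable_stepWeight (f : ℝ → ℝ → ℝ) (n : ℕ) :
    Measurable (stepWeight f n : (Fin m → ℝ) → ℝ) := by
  classical
  have h1 : Measurable fun (u : Fin m → ℝ) (j : Fin m) => ⌈(n : ℝ) * u j⌉₊ :=
    measurable_pi_lambda _ fun j => Nat.measurable_ceil.comp ((measurable_pi_apply j).const_mul _)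
  have h2 : Measurable fun w : Fin m → ℕ =>
      if StrictMono (nodes n w) then scaledWeight f n (nodes n w) else 0 := Measurable.of_discrete
  exact h2.comp h1

theorem ceil_eq_iff {n : ℕ} (hn : 0 < n) (x : ℝ) (a : ℕ) :
    ⌈(n : ℝ) * x⌉₊ = a + 1 ↔ x ∈ Ioc ((a : ℝ) / n) ((a + 1 : ℝ) / n) := by
  have hn' : (0 : ℝ) < n := by exact_mod_cast hn
  rw [Nat.ceil_eq_iff a.succ_ne_zero, Set.mem_Ioc, div_lt_iff₀' hn', le_div_iff₀' hn']
  simp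

/-- Rounding up is constant on cells of side `1 / n` that are open on the left and closed on the
right; these cells partition `cube m`. -/
theorem setIntegral_stepWeight (f : ℝ → ℝ → ℝ) {n : ℕ} (hn : 0 < n) :
    ∫ u in cube m, stepWeight f n u = pathSum f m n := by
  classical
  have hn' : (0 : ℝ) < n := by exact_mod_cast hn
  let cell : (Fin m → Fin n) → Set (Fin m → ℝ) := fun v =>
    Set.pi univ fun j => Ioc (((v j : ℕ) : ℝ) / n) (((v j : ℕ) + 1 : ℝ) / n)
  have hcell : ∀ v u, u ∈ cell v ↔ ∀ j, ⌈(n : ℝ) * u j⌉₊ = (v j : ℕ) + 1 := fun v u => by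
    simp only [cell, Set.mem_pi, mem_univ, true_imp_iff, ceil_eq_iff hn]
  have hunion : cube m = ⋃ v, cell v := by
    ext u
    simp only [Set.mem_iUnion, hcell]
    simp only [cube, Set.mem_pi, mem_univ, true_imp_iff]
    constructor
    · intro hu
      have h1 : ∀ j, 0 < ⌈(n : ℝ) * u j⌉₊ := fun j => Nat.ceil_pos.2 (mul_pos hn' (hu j).1)
      have h2 : ∀ j, ⌈(n : ℝ) * u j⌉₊ ≤ n := fun j => Nat.ceil_le.2 (by nlinarith [(hu j).2])
      refine ⟨fun j => ⟨⌈(n : ℝ) * u j⌉₊ - 1, ?_⟩, fun j => ?_⟩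
      · have := h1 j; have := h2 j; omega
      · have := h1 j; show _ = _ - 1 + 1; omega
    · rintro ⟨v, hv⟩ j
      have h := (ceil_eq_iff hn _ _).1 (hv j)
      refine ⟨lt_of_le_of_lt (by positivity) h.1, h.2.trans ?_⟩
      rw [div_le_one hn']
      exact_mod_cast (v j).2
  have hdisj : Pairwise (Function.onFun Disjoint cell) := by
    intro v w hvw
    refine Set.disjoint_left.2 fun u hu hu' => hvw ?_
    rw [hcell] at hu hu'
    funext j
    exact Fin.ext (by have := hu j; have := hu' j; omega)
  have hvol : ∀ v, volume.real (cell v) = ((n : ℝ) ^ m)⁻¹ := by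
    intro v
    rw [measureReal_def, Real.volume_pi_Ioc_toReal]
    · simp [← sub_div]
    · intro j
      show ((v j : ℕ) : ℝ) / n ≤ ((v j : ℕ) + 1 : ℝ) / n
      gcongr
      linarith
  have hm : ∀ v, MeasurableSet (cell v) := fun v => MeasurableSet.univ_pi fun _ => measurableSet_Ioc
  have hconst : ∀ v, EqOn (stepWeight f n)
      (fun _ => if StrictMono (route v) then scaledWeight f n (route v) else 0) (cell v) := by
    intro v u hu
    have : ceilNodes n u = route v := by
      rw [ceilNodes, route]
      congr 1
      exact funext ((hcell v u).1 hu)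
    simp only [stepWeight, this]
  have hfin : ∀ v, volume (cell v) ≠ ⊤ := fun v h => by
    have h1 := hvol v
    rw [measureReal_def, h, ENNReal.toReal_top] at h1
    have : 0 < ((n : ℝ) ^ m)⁻¹ := by positivity
    linarith
  rw [hunion, integral_iUnion_fintype hm hdisj fun v =>
    (integrableOn_const (hfin v)).congr_fun (hconst v).symm (hm v)]
  rw [pathSum, paths, Finset.sum_filter, Finset.sum_div]
  refine Finset.sum_congr rfl fun v _ => ?_
  rw [setIntegral_congr_fun (hm v) (hconst v), setIntegral_const, hvol, smul_eq_mul, div_eq_inv_mul]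

/-- A surjective linear map pushes Lebesgue measure to a multiple of Haar measure (possibly
infinite), so preimages of null sets are null. -/
theorem ae_comp_linearMap {n : ℕ} {F : Type*} [NormedAddCommGroup F] [NormedSpace ℝ F]
    [MeasureSpace F] [BorelSpace F] [FiniteDimensional ℝ F]
    [(volume : Measure F).IsAddHaarMeasure] (L : (Fin n → ℝ) →ₗ[ℝ] F)
    (hL : Function.Surjective L) {p : F → Prop} (hp : ∀ᵐ y, p y) : ∀ᵐ u, p (L u) := by
  obtain ⟨c, -, hc⟩ := L.exists_map_addHaar_eq_smul_addHaar volume volume hL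
  refine ae_of_ae_map (L.continuous_of_finiteDimensional.aemeasurable) (p := p) ?_
  rw [hc]
  exact hp.filter_mono (Measure.ae_smul_measure_le c)

theorem ae_comp_apply {n : ℕ} (i : Fin n) {p : ℝ → Prop} (hp : ∀ᵐ y, p y) :
    ∀ᵐ u : Fin n → ℝ, p (u i) :=
  ae_comp_linearMap (LinearMap.proj i) (fun y => ⟨fun _ => y, rfl⟩) hp

theorem ae_comp_pair {n : ℕ} {i j : Fin n} (hij : i ≠ j) {p : (Fin 2 → ℝ) → Prop}
    (hp : ∀ᵐ y, p y) : ∀ᵐ u : Fin n → ℝ, p ![u i, u j] := by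
  have h := ae_comp_linearMap (n := n)
    (LinearMap.pi ![LinearMap.proj (R := ℝ) (φ := fun _ => ℝ) i, LinearMap.proj j])
    (fun y => ⟨Function.update (fun _ => y 1) i (y 0), by
      ext l
      fin_cases l
      · simp
      · simp [hij.symm]⟩) hp
  refine h.mono fun u hu => ?_
  convert hu using 1
  ext l
  fin_cases l <;> rfl

theorem ae_apply_ne_apply : ∀ᵐ x : Fin 2 → ℝ, x 0 ≠ x 1 := by
  have h : ∀ᵐ y : ℝ, y ≠ 0 := by simp [ae_iff]
  have h' := ae_comp_linearMap (n := 2)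
    (LinearMap.proj (R := ℝ) (φ := fun _ => ℝ) 0 - LinearMap.proj 1)
    (fun y => ⟨![y, 0], by simp⟩) h
  exact h'.mono fun x hx hxx => hx (by simp [hxx])

variable {f : ℝ → ℝ → ℝ}

/-- The hypotheses on `f`: positivity and boundedness on the square, and continuity almost
everywhere in the square, on its left side and on its upper side. -/
structure Admissible (f : ℝ → ℝ → ℝ) (C : ℝ) : Prop where
  one_le : 1 ≤ C
  pos : ∀ x ∈ Icc (0 : ℝ) 1, ∀ y ∈ Icc (0 : ℝ) 1, 0 < f x y
  le : ∀ x ∈ Icc (0 : ℝ) 1, ∀ y ∈ Icc (0 : ℝ) 1, f x y ≤ C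
  continuousAt : ∀ᵐ x : Fin 2 → ℝ, x 0 ∈ Icc (0 : ℝ) 1 → x 1 ∈ Icc (0 : ℝ) 1 →
    ContinuousAt (fun x : Fin 2 → ℝ => f (x 0) (x 1)) x
  left : ∀ᵐ y : ℝ, y ∈ Icc (0 : ℝ) 1 →
    ContinuousWithinAt (Function.uncurry f) (Icc (0 : ℝ) 1 ×ˢ Icc (0 : ℝ) 1) (0, y)
  right : ∀ᵐ x : ℝ, x ∈ Icc (0 : ℝ) 1 →
    ContinuousWithinAt (Function.uncurry f) (Icc (0 : ℝ) 1 ×ˢ Icc (0 : ℝ) 1) (x, 1)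

variable {C : ℝ}

/-- With at least one intermediate point, no factor is `f 0 1`: the first pair lies on the left
side, the last on the upper side, and the others are pairs of distinct coordinates, to which
continuity almost everywhere in the square applies. -/
theorem Admissible.ae_gridPoints (hf : Admissible f C) (i : Fin (m + 2)) :
    ∀ᵐ u : Fin (m + 1) → ℝ, gridPoints u i.castSucc ≠ gridPoints u i.succ ∧
      (u ∈ cube (m + 1) → ContinuousWithinAt (Function.uncurry f) (Icc (0 : ℝ) 1 ×ˢ Icc (0 : ℝ) 1)
        (gridPoints u i.castSucc, gridPoints u i.succ)) := by
  have hIcc : ∀ {u : Fin (m + 1) → ℝ} {j}, u ∈ cube (m + 1) → u j ∈ Icc (0 : ℝ) 1 :=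
    fun h => Ioc_subset_Icc_self (h _ (mem_univ _))
  have hne : ∀ a : ℝ, ∀ᵐ y : ℝ, y ≠ a := fun a => by simp [ae_iff]
  revert i
  refine fin_cases_ends ?_ ?_ fun i => ?_
  · have h0 : ∀ u : Fin (m + 1) → ℝ, gridPoints u (Fin.succ 0) = u 0 := fun u =>
      gridPoints_castSucc_succ u 0
    filter_upwards [ae_comp_apply (0 : Fin (m + 1)) hf.left, ae_comp_apply (0 : Fin (m + 1)) (hne 0)]
      with u h1 h2
    rw [h0, Fin.castSucc_zero, gridPoints_zero]
    exact ⟨h2.symm, fun hu => h1 (hIcc hu)⟩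
  · have h0 : ∀ u : Fin (m + 1) → ℝ, gridPoints u (Fin.last (m + 1)).castSucc = u (Fin.last m) :=
      fun u => gridPoints_castSucc_succ u (Fin.last m)
    filter_upwards [ae_comp_apply (Fin.last m) hf.right, ae_comp_apply (Fin.last m) (hne 1)]
      with u h1 h2
    rw [h0, Fin.succ_last, gridPoints_last]
    exact ⟨h2, fun hu => h1 (hIcc hu)⟩
  · have h0 : ∀ u : Fin (m + 1) → ℝ, gridPoints u i.succ.castSucc.castSucc = u i.castSucc :=
      fun u => gridPoints_castSucc_succ u i.castSucc
    have h1 : ∀ u : Fin (m + 1) → ℝ, gridPoints u i.succ.castSucc.succ = u i.succ :=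
      fun u => gridPoints_castSucc_succ u i.succ
    have hi : i.castSucc ≠ i.succ := Fin.castSucc_lt_succ.ne
    filter_upwards [ae_comp_pair hi hf.continuousAt, ae_comp_pair hi ae_apply_ne_apply]
      with u h2 h3
    rw [h0, h1]
    refine ⟨h3, fun hu => ?_⟩
    have h4 := h2 (hIcc hu) (hIcc hu)
    have h5 : ContinuousAt (fun p : ℝ × ℝ => (![p.1, p.2] : Fin 2 → ℝ)) (u i.castSucc, u i.succ) := by
      refine continuousAt_pi.2 fun l => ?_
      fin_cases l
      · exact continuousAt_fst
      · exact continuousAt_snd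
    exact (ContinuousAt.comp (f := fun p : ℝ × ℝ => (![p.1, p.2] : Fin 2 → ℝ)) h4 h5).continuousWithinAt

theorem ceilNodes_div_mem {n : ℕ} (hn : 0 < n) {u : Fin m → ℝ} (hu : u ∈ cube m) (i : Fin (m + 2)) :
    (ceilNodes n u i : ℝ) / n ∈ Icc (0 : ℝ) 1 := by
  have hn' : (0 : ℝ) < n := by exact_mod_cast hn
  refine ⟨by positivity, (div_le_one hn').2 (Nat.cast_le.2 ?_)⟩
  revert i
  refine fin_cases_ends ?_ ?_ fun i => ?_
  · exact hn
  · simp [ceilNodes]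
  · rw [ceilNodes, nodes_castSucc_succ]
    exact Nat.ceil_le.2 (by nlinarith [(hu i (mem_univ _)).2])

theorem tendsto_ceilNodes_div {u : Fin m → ℝ} (hu : u ∈ cube m) (i : Fin (m + 2)) :
    Tendsto (fun n : ℕ => (ceilNodes n u i : ℝ) / n) atTop (𝓝 (gridPoints u i)) := by
  revert i
  refine fin_cases_ends ?_ ?_ fun i => ?_
  · simpa [ceilNodes] using tendsto_inv_atTop_nhds_zero_nat (𝕜 := ℝ)
  · rw [gridPoints_last]
    refine tendsto_const_nhds.congr' ?_
    filter_upwards [eventually_gt_atTop 0] with n hn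
    have hn' : (n : ℝ) ≠ 0 := by exact_mod_cast hn.ne'
    simp [ceilNodes, hn']
  · simp only [ceilNodes, nodes_castSucc_succ, gridPoints_castSucc_succ]
    have h := (tendsto_nat_ceil_mul_div_atTop (hu i (mem_univ _)).1.le).comp
      (tendsto_natCast_atTop_atTop (R := ℝ))
    simpa only [Function.comp_def, mul_comm] using! h

theorem scaledWeight_mem (hf : Admissible f C) {n : ℕ} {x : Fin (m + 2) → ℕ}
    (hx : ∀ i, (x i : ℝ) / n ∈ Icc (0 : ℝ) 1) :
    0 ≤ scaledWeight f n x ∧ scaledWeight f n x ≤ C ^ (m + 1) := by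
  refine ⟨Finset.prod_nonneg fun j _ => (hf.pos _ (hx _) _ (hx _)).le, ?_⟩
  refine (Finset.prod_le_prod (fun j _ => (hf.pos _ (hx _) _ (hx _)).le)
    fun j _ => hf.le _ (hx _) _ (hx _)).trans_eq ?_
  simp

theorem Admissible.tendsto_stepWeight (hf : Admissible f C) :
    ∀ᵐ u ∂(volume.restrict (cube (m + 1))), Tendsto (fun n => stepWeight f n u) atTop
      (𝓝 ((openSimplex (m + 1)).indicator (pathWeight f) u)) := by
  rw [ae_restrict_iff' measurableSet_cube]
  filter_upwards [ae_all_iff.2 fun i => hf.ae_gridPoints (m := m) i] with u hgrid hu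
  have hlim := tendsto_ceilNodes_div hu
  by_cases hs : u ∈ openSimplex (m + 1)
  · rw [Set.indicator_of_mem hs]
    have hmono : ∀ᶠ n in atTop, StrictMono (ceilNodes n u) := by
      have : ∀ i : Fin (m + 2), ∀ᶠ n : ℕ in atTop,
          ceilNodes n u i.castSucc < ceilNodes n u i.succ := by
        intro i
        filter_upwards [(hlim i.castSucc).eventually_lt (hlim i.succ) (hs Fin.castSucc_lt_succ),
          eventually_gt_atTop 0] with n hn hn0
        have hn' : (0 : ℝ) < n := by exact_mod_cast hn0
        exact_mod_cast (div_lt_div_iff_of_pos_right hn').1 hn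
      filter_upwards [eventually_all.2 this] with n hn
      exact Fin.strictMono_iff_lt_succ.2 hn
    have hT : Tendsto (fun n => scaledWeight f n (ceilNodes n u)) atTop (𝓝 (pathWeight f u)) := by
      refine tendsto_finsetProd _ fun i _ => ?_
      refine Tendsto.comp (g := Function.uncurry f) ((hgrid i).2 hu)
        (f := fun n : ℕ => ((ceilNodes n u i.castSucc : ℝ) / n, (ceilNodes n u i.succ : ℝ) / n)) ?_
      refine tendsto_nhdsWithin_iff.2 ⟨(hlim _).prodMk_nhds (hlim _), ?_⟩
      filter_upwards [eventually_gt_atTop 0] with n hn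
      exact ⟨ceilNodes_div_mem hn hu _, ceilNodes_div_mem hn hu _⟩
    refine hT.congr' ?_
    filter_upwards [hmono] with n hn
    rw [stepWeight, if_pos hn]
  · rw [Set.indicator_of_notMem hs]
    refine tendsto_const_nhds.congr' ?_
    -- Ties have been excluded almost everywhere, so failure of monotonicity means a strict descent,
    -- which survives rounding for large `n`.
    have : ∃ i : Fin (m + 2), gridPoints u i.succ < gridPoints u i.castSucc := by
      by_contra! h
      exact hs (Fin.strictMono_iff_lt_succ.2 fun i => lt_of_le_of_ne (h i) (hgrid i).1)
    obtain ⟨i, hi⟩ := this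
    filter_upwards [(hlim i.succ).eventually_lt (hlim i.castSucc) hi, eventually_gt_atTop 0]
      with n hn hn0
    have hn' : (0 : ℝ) < n := by exact_mod_cast hn0
    have h : ceilNodes n u i.succ < ceilNodes n u i.castSucc := by
      exact_mod_cast (div_lt_div_iff_of_pos_right hn').1 hn
    rw [stepWeight, if_neg fun h' => (h.trans (h' Fin.castSucc_lt_succ)).false]

theorem Admissible.norm_stepWeight_le (hf : Admissible f C) {n : ℕ} (hn : 0 < n) {u : Fin m → ℝ}
    (hu : u ∈ cube m) : ‖stepWeight f n u‖ ≤ C ^ (m + 1) := by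
  have h := scaledWeight_mem hf (ceilNodes_div_mem hn hu)
  rw [stepWeight]
  split_ifs
  · rw [Real.norm_of_nonneg h.1]
    exact h.2
  · simpa using h.1.trans h.2

theorem Admissible.pathWeight_pos (hf : Admissible f C) {u : Fin m → ℝ} (hu : u ∈ openSimplex m) :
    0 < pathWeight f u :=
  Finset.prod_pos fun _ _ => hf.pos _ (gridPoints_mem_Icc hu _) _ (gridPoints_mem_Icc hu _)

theorem Admissible.pathWeight_le (hf : Admissible f C) {u : Fin m → ℝ} (hu : u ∈ openSimplex m) :
    pathWeight f u ≤ C ^ (m + 1) :=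
  (Finset.prod_le_prod
    (fun _ _ => (hf.pos _ (gridPoints_mem_Icc hu _) _ (gridPoints_mem_Icc hu _)).le)
    fun _ _ => hf.le _ (gridPoints_mem_Icc hu _) _ (gridPoints_mem_Icc hu _)).trans_eq (by simp)

theorem Admissible.integrableOn_pathWeight (hf : Admissible f C) :
    IntegrableOn (pathWeight f) (openSimplex (m + 1)) := by
  have hmeas := aestronglyMeasurable_of_tendsto_ae atTop
    (fun n => (measurable_stepWeight f n).aestronglyMeasurable) (hf.tendsto_stepWeight (m := m))
  have hfin : volume (openSimplex (m + 1)) ≠ ⊤ :=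
    ((measure_mono openSimplex_subset_cube).trans_lt (by rw [volume_cube]; simp)).ne
  have hS := isOpen_openSimplex (m := m + 1).measurableSet
  -- Measurability of `f` is not a hypothesis; on the simplex the integrand is an almost everywhere
  -- limit of measurable step functions.
  have hmeas' : AEStronglyMeasurable (pathWeight f) (volume.restrict (openSimplex (m + 1))) := by
    rw [aestronglyMeasurable_indicator_iff hS, Measure.restrict_restrict hS,
      Set.inter_eq_left.2 openSimplex_subset_cube] at hmeas
    exact hmeas
  have : IsFiniteMeasure (volume.restrict (openSimplex (m + 1))) :=
    ⟨by rw [Measure.restrict_apply_univ]; exact hfin.lt_top⟩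
  refine Integrable.of_bound hmeas' (C ^ (m + 2)) ?_
  refine (ae_restrict_iff' hS).2 (Eventually.of_forall fun u hu => ?_)
  rw [Real.norm_of_nonneg (hf.pathWeight_pos hu).le]
  exact hf.pathWeight_le hu

theorem Admissible.tendsto_pathSum (hf : Admissible f C) :
    Tendsto (pathSum f (m + 1)) atTop (𝓝 (∫ u in openSimplex (m + 1), pathWeight f u)) := by
  have hS := isOpen_openSimplex (m := m + 1).measurableSet
  have hlim : ∫ u in openSimplex (m + 1), pathWeight f u =
      ∫ u in cube (m + 1), (openSimplex (m + 1)).indicator (pathWeight f) u := by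
    rw [integral_indicator hS, Measure.restrict_restrict hS,
      Set.inter_eq_left.2 openSimplex_subset_cube]
  rw [hlim]
  have hfin : IsFiniteMeasure (volume.restrict (cube (m + 1))) :=
    ⟨by rw [Measure.restrict_apply_univ, volume_cube]; simp⟩
  have h := tendsto_integral_filter_of_dominated_convergence
    (μ := volume.restrict (cube (m + 1))) (l := atTop) (F := fun n => stepWeight f n)
    (fun _ => C ^ (m + 2)) (Eventually.of_forall fun n =>
      (measurable_stepWeight f n).aestronglyMeasurable)
    (by
      filter_upwards [eventually_gt_atTop 0] with n hn
      exact (ae_restrict_iff' measurableSet_cube).2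
        (Eventually.of_forall fun u hu => hf.norm_stepWeight_le hn hu))
    (integrable_const _) hf.tendsto_stepWeight
  refine h.congr' ?_
  filter_upwards [eventually_gt_atTop 0] with n hn
  exact setIntegral_stepWeight f hn

theorem Admissible.integral_pathWeight_pos (hf : Admissible f C) :
    0 < ∫ u in openSimplex (m + 1), pathWeight f u := by
  have hS := isOpen_openSimplex (m := m + 1).measurableSet
  rw [setIntegral_pos_iff_support_of_nonneg_ae
    ((ae_restrict_iff' hS).2 (Eventually.of_forall fun u hu => (hf.pathWeight_pos hu).le))
    hf.integrableOn_pathWeight]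
  have hsub : openSimplex (m + 1) ⊆ Function.support (pathWeight f) := fun u hu =>
    (hf.pathWeight_pos hu).ne'
  rw [Set.inter_eq_right.2 hsub]
  exact isOpen_openSimplex.measure_pos _ nonempty_openSimplex

end RiemannSums

/-! ### Asymptotics of the probability of having no path of a given length -/

section Limits

variable {f : ℝ → ℝ → ℝ} {C γ : ℝ} {n m : ℕ}

theorem coe_edgeProb (hf : Admissible f C) (hn : 0 < n) (hC : C ≤ (n : ℝ) ^ γ) (e : Edge n) :
    (edgeProb f γ e : ℝ) = f ((e.1.1 : ℕ) / (n : ℝ)) ((e.1.2 : ℕ) / (n : ℝ)) / (n : ℝ) ^ γ := by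
  have hn' : (0 : ℝ) < n := by exact_mod_cast hn
  have hpow : (0 : ℝ) < (n : ℝ) ^ γ := Real.rpow_pos_of_pos hn' γ
  have hmem : ∀ i : Vertex n, ((i : ℕ) : ℝ) / n ∈ Icc (0 : ℝ) 1 := fun i =>
    ⟨by positivity, (div_le_one hn').2 (by exact_mod_cast (Finset.mem_Icc.1 i.2).2)⟩
  have h : f ((e.1.1 : ℕ) / (n : ℝ)) ((e.1.2 : ℕ) / (n : ℝ)) / (n : ℝ) ^ γ ∈ Icc (0 : ℝ) 1 :=
    ⟨div_nonneg (hf.pos _ (hmem _) _ (hmem _)).le hpow.le,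
      (div_le_one hpow).2 ((hf.le _ (hmem _) _ (hmem _)).trans hC)⟩
  rw [edgeProb, Set.projIcc_of_mem _ h]

theorem edgeProb_le (hf : Admissible f C) (hn : 0 < n) (hC : C ≤ (n : ℝ) ^ γ) (e : Edge n) :
    (edgeProb f γ e : ℝ) ≤ C / (n : ℝ) ^ γ := by
  have hn' : (0 : ℝ) < n := by exact_mod_cast hn
  have hmem : ∀ i : Vertex n, ((i : ℕ) : ℝ) / n ∈ Icc (0 : ℝ) 1 := fun i =>
    ⟨by positivity, (div_le_one hn').2 (by exact_mod_cast (Finset.mem_Icc.1 i.2).2)⟩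
  rw [coe_edgeProb hf hn hC]
  have := Real.rpow_pos_of_pos hn' γ
  gcongr
  exact hf.le _ (hmem _) _ (hmem _)

/-- The order of magnitude `n ^ (k (1 - γ) - 1)` of the expected number of paths with `k = m + 1`
edges. -/
noncomputable def pathScale (γ : ℝ) (m n : ℕ) : ℝ := (n : ℝ) ^ m / ((n : ℝ) ^ γ) ^ (m + 1)

theorem pathScale_eq_rpow (hn : 0 < n) :
    pathScale γ m n = (n : ℝ) ^ ((m + 1 : ℝ) * (1 - γ) - 1) := by
  have hn' : (0 : ℝ) < n := by exact_mod_cast hn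
  rw [pathScale, ← Real.rpow_natCast, ← Real.rpow_natCast, ← Real.rpow_mul hn'.le,
    ← Real.rpow_sub hn']
  congr 1
  push_cast
  ring

theorem tendsto_pathScale_zero (h : (m + 1 : ℝ) * (1 - γ) < 1) :
    Tendsto (pathScale γ m) atTop (𝓝 0) := by
  have h1 := (tendsto_rpow_neg_atTop (sub_pos.2 h)).comp (tendsto_natCast_atTop_atTop (R := ℝ))
  refine h1.congr' ?_
  filter_upwards [eventually_gt_atTop 0] with n hn
  rw [pathScale_eq_rpow hn, Function.comp_apply, neg_sub]

theorem pathScale_eq_one (h : (m + 1 : ℝ) * (1 - γ) = 1) (hn : 0 < n) : pathScale γ m n = 1 := by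
  rw [pathScale_eq_rpow hn, h, sub_self, Real.rpow_zero]

theorem tendsto_pathScale_atTop (h : 1 < (m + 1 : ℝ) * (1 - γ)) :
    Tendsto (pathScale γ m) atTop atTop := by
  have h1 := (tendsto_rpow_atTop (sub_pos.2 h)).comp (tendsto_natCast_atTop_atTop (R := ℝ))
  refine h1.congr' ?_
  filter_upwards [eventually_gt_atTop 0] with n hn
  rw [pathScale_eq_rpow hn, Function.comp_apply]

/-- The expected number of increasing paths from `1` to `n` with `m + 1` edges. -/
noncomputable def expectedPaths (f : ℝ → ℝ → ℝ) (γ : ℝ) (m n : ℕ) : ℝ :=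
  ∑ v ∈ paths n m, (law f γ n).real (allTrue (pathEdges v))

theorem expectedPaths_eq (hf : Admissible f C) (hn : 0 < n) (hC : C ≤ (n : ℝ) ^ γ) :
    expectedPaths f γ m n = pathSum f m n * pathScale γ m n := by
  have hn' : (0 : ℝ) < n := by exact_mod_cast hn
  have hpow : (0 : ℝ) < (n : ℝ) ^ γ := Real.rpow_pos_of_pos hn' γ
  have hpow' : (n : ℝ) ^ m ≠ 0 := by positivity
  rw [pathSum, pathScale, div_mul_div_cancel₀ hpow', Finset.sum_div]
  refine Finset.sum_congr rfl fun v hv => ?_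
  have hv' := mem_paths.1 hv
  have h := bernoulliProduct_real_allTrue (edgeProb f γ (n := n)) (pathEdges v)
  refine h.trans ?_
  rw [pathEdges_eq_map hv', Finset.prod_map, scaledWeight]
  have h2 : ((n : ℝ) ^ γ) ^ (m + 1) = ∏ _j : Fin (m + 1), (n : ℝ) ^ γ := by simp
  rw [h2, ← Finset.prod_div_distrib]
  exact Finset.prod_congr rfl fun j _ => coe_edgeProb hf hn hC _

theorem scaled_pow_eq : (n : ℝ) ^ m * (C / (n : ℝ) ^ γ) ^ (m + 1) = C ^ (m + 1) * pathScale γ m n := by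
  rw [pathScale, div_pow]
  ring

theorem expectedPaths_le (hf : Admissible f C) (hn : 0 < n) (hC : C ≤ (n : ℝ) ^ γ) :
    expectedPaths f γ m n ≤ C ^ (m + 1) * pathScale γ m n := by
  have h1 : ∀ v ∈ paths n m, (law f γ n).real (allTrue (pathEdges v)) ≤
      (C / (n : ℝ) ^ γ) ^ (m + 1) := fun v hv =>
    allTrue_pathEdges_le (edgeProb f γ) (edgeProb_le hf hn hC) (mem_paths.1 hv)
  have h2 := Finset.sum_le_card_nsmul _ _ _ h1
  have hcard : ((paths n m).card : ℝ) ≤ (n : ℝ) ^ m := by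
    have h3 := Finset.card_le_univ (paths n m)
    have h4 : Fintype.card (Fin m → Fin n) = n ^ m := by simp
    rw [h4] at h3
    exact_mod_cast h3
  rw [nsmul_eq_mul] at h2
  refine h2.trans ?_
  rw [← scaled_pow_eq]
  have hC0 : 0 ≤ C := zero_le_one.trans hf.one_le
  gcongr

/-- The probability that there is no increasing path with `m + 1` edges. -/
noncomputable def missProb (f : ℝ → ℝ → ℝ) (γ : ℝ) (m n : ℕ) : ℝ :=
  (law f γ n).real (noneTrue pathEdges (paths n m))

instance : IsProbabilityMeasure (law f γ n) :=
  inferInstanceAs (IsProbabilityMeasure (bernoulliProduct (edgeProb f γ)))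

theorem probReal_compl_noneTrue :
    (law f γ n).real (noneTrue pathEdges (paths n m))ᶜ = 1 - missProb f γ m n :=
  probReal_compl_eq_one_sub (Set.toFinite _).measurableSet

theorem one_sub_missProb_nonneg : 0 ≤ 1 - missProb f γ m n := by
  rw [← probReal_compl_noneTrue]
  exact measureReal_nonneg

theorem one_sub_missProb_le : 1 - missProb f γ m n ≤ expectedPaths f γ m n := by
  rw [← probReal_compl_noneTrue]
  have hsub : (noneTrue pathEdges (paths n m))ᶜ ⊆ ⋃ v ∈ paths n m, allTrue (pathEdges v) := by
    intro ω hω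
    simpa [noneTrue] using hω
  exact (measureReal_mono hsub (measure_ne_top _ _)).trans (measureReal_biUnion_finset_le _ _)

theorem eventually_le_rpow (hγ : 0 < γ) (C : ℝ) : ∀ᶠ n : ℕ in atTop, C ≤ (n : ℝ) ^ γ :=
  ((tendsto_rpow_atTop hγ).comp tendsto_natCast_atTop_atTop).eventually_ge_atTop C

theorem tendsto_one_sub_missProb_zero (hf : Admissible f C) (hγ : 0 < γ)
    (h : (m + 1 : ℝ) * (1 - γ) < 1) :
    Tendsto (fun n => 1 - missProb f γ m n) atTop (𝓝 0) := by
  have h1 := (tendsto_pathScale_zero h).const_mul (C ^ (m + 1))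
  rw [mul_zero] at h1
  refine squeeze_zero' (Eventually.of_forall fun n => one_sub_missProb_nonneg) ?_ h1
  filter_upwards [eventually_gt_atTop 0, eventually_le_rpow hγ C] with n hn hC
  exact one_sub_missProb_le.trans (expectedPaths_le hf hn hC)

theorem one_sub_missProb_le_probShortestLE (hn : 2 ≤ n) {k : ℕ} (hm : m < k) :
    1 - missProb f γ m n ≤ probShortestLE f γ n k := by
  rw [← probReal_compl_noneTrue, probShortestLE]
  exact measureReal_mono fun ω hω => (shortestPath_le_iff hn ω k).2 ⟨m, hm, hω⟩

theorem probShortestLE_le_sum (hn : 2 ≤ n) (k : ℕ) :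
    probShortestLE f γ n k ≤ ∑ m ∈ Finset.range k, (1 - missProb f γ m n) := by
  simp only [← probReal_compl_noneTrue]
  rw [probShortestLE]
  refine (measureReal_mono ?_ (measure_ne_top _ _)).trans (measureReal_biUnion_finset_le _ _)
  intro ω hω
  obtain ⟨m, hm, h⟩ := (shortestPath_le_iff hn ω k).1 hω
  exact mem_biUnion (Finset.mem_range.2 hm) h

/-- The overlap of the families of edges of the paths with `m + 1` edges. -/
noncomputable def pathOverlap (f : ℝ → ℝ → ℝ) (γ : ℝ) (m n : ℕ) : ℝ :=
  overlap (edgeProb f γ) pathEdges (paths n m)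

/-- Taking `B = C / n ^ γ` in `overlap_pathEdges_le` gives `n + m * B⁻¹ = n * (1 + m / (C * n ^ (1 -
γ)))`, whose second summand tends to zero relative to `n` precisely because `γ < 1`. -/
theorem exists_pathOverlap_le (hf : Admissible f C) (hγ : 0 < γ) (hγ1 : γ < 1) (m : ℕ) :
    ∃ r : ℕ → ℝ, Tendsto r atTop (𝓝 0) ∧
      ∀ᶠ n in atTop, pathOverlap f γ m n ≤ r n * pathScale γ m n ^ 2 := by
  have hC0 : 0 < C := zero_lt_one.trans_le hf.one_le
  refine ⟨fun n => (C ^ (m + 1)) ^ 2 * ((1 + m * (C * (n : ℝ) ^ (1 - γ))⁻¹) ^ m - 1), ?_, ?_⟩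
  · have h1 : Tendsto (fun n : ℕ => C * (n : ℝ) ^ (1 - γ)) atTop atTop :=
      ((tendsto_rpow_atTop (sub_pos.2 hγ1)).comp tendsto_natCast_atTop_atTop).const_mul_atTop hC0
    have h2 := (((h1.inv_tendsto_atTop.const_mul (m : ℝ)).const_add 1).pow m).sub_const 1
    have h3 := h2.const_mul ((C ^ (m + 1)) ^ 2)
    simpa using! h3
  · filter_upwards [eventually_gt_atTop 0, eventually_le_rpow hγ C] with n hn hC
    have hn' : (0 : ℝ) < n := by exact_mod_cast hn
    have hpow : (0 : ℝ) < (n : ℝ) ^ γ := Real.rpow_pos_of_pos hn' γ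
    refine (overlap_pathEdges_le (edgeProb f γ) (div_pos hC0 hpow) ((div_le_one hpow).2 hC)
      (edgeProb_le hf hn hC)).trans_eq ?_
    have h1 : (n : ℝ) + m * (C / (n : ℝ) ^ γ)⁻¹ = n * (1 + m * (C * (n : ℝ) ^ (1 - γ))⁻¹) := by
      rw [Real.rpow_sub hn', Real.rpow_one]
      field_simp
    rw [h1, mul_pow]
    calc _ = ((n : ℝ) ^ m * (C / (n : ℝ) ^ γ) ^ (m + 1)) ^ 2 *
          ((1 + m * (C * (n : ℝ) ^ (1 - γ))⁻¹) ^ m - 1) := by ring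
      _ = _ := by rw [scaled_pow_eq]; ring

/-- Since `1 / (1 - x) = 1 + x / (1 - x) ≤ 1 + x / (1 - b) ≤ exp (x / (1 - b))`. This turns Harris'
product into the exponential of a sum, with a uniform correction `1 / (1 - b)`. -/
theorem exp_neg_div_le {x b : ℝ} (hx : 0 ≤ x) (hxb : x ≤ b) (hb : b < 1) :
    Real.exp (-(x / (1 - b))) ≤ 1 - x := by
  have h1 : 0 < 1 - x := by linarith
  have h2 : 0 < 1 - b := by linarith
  rw [Real.exp_neg]
  refine inv_le_of_inv_le₀ h1 ?_
  have h3 : (1 - x)⁻¹ = x / (1 - x) + 1 := by field_simp; ring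
  have h4 : x / (1 - x) ≤ x / (1 - b) := by gcongr
  rw [h3]
  have := Real.add_one_le_exp (x / (1 - b))
  linarith

/-- Here `pathScale` equals `1`, so the mean converges to the integral. In the lower bound `b` is
the uniform bound on a single path's probability, which vanishes; in the upper bound the overlap
vanishes. -/
theorem tendsto_missProb_critical (hf : Admissible f C) (hγ : 0 < γ) (hγ1 : γ < 1)
    (h : ((m + 1 : ℕ) + 1 : ℝ) * (1 - γ) = 1) :
    Tendsto (missProb f γ (m + 1)) atTop
      (𝓝 (Real.exp (-∫ u in openSimplex (m + 1), pathWeight f u))) := by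
  obtain ⟨r, hr, hover⟩ := exists_pathOverlap_le hf hγ hγ1 (m + 1)
  have hmean : Tendsto (expectedPaths f γ (m + 1)) atTop
      (𝓝 (∫ u in openSimplex (m + 1), pathWeight f u)) := by
    refine hf.tendsto_pathSum.congr' ?_
    filter_upwards [eventually_gt_atTop 0, eventually_le_rpow hγ C] with n hn hC
    rw [expectedPaths_eq hf hn hC, pathScale_eq_one h hn, mul_one]
  have hb : Tendsto (fun n : ℕ => (C / (n : ℝ) ^ γ) ^ (m + 2)) atTop (𝓝 0) := by
    have h1 := ((tendsto_rpow_atTop hγ).comp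
      (tendsto_natCast_atTop_atTop (R := ℝ))).const_div_atTop C |>.pow (m + 2)
    simpa using! h1
  have hlow : Tendsto (fun n : ℕ => Real.exp (-(expectedPaths f γ (m + 1) n /
      (1 - (C / (n : ℝ) ^ γ) ^ (m + 2))))) atTop
      (𝓝 (Real.exp (-∫ u in openSimplex (m + 1), pathWeight f u))) := by
    have h1 := (hmean.div (hb.const_sub 1) (by norm_num)).neg
    rw [sub_zero, div_one] at h1
    exact (Real.continuous_exp.tendsto _).comp h1
  have hup : Tendsto (fun n : ℕ => Real.exp (-expectedPaths f γ (m + 1) n + r n)) atTop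
      (𝓝 (Real.exp (-∫ u in openSimplex (m + 1), pathWeight f u))) := by
    have h1 := hmean.neg.add hr
    rw [add_zero] at h1
    exact (Real.continuous_exp.tendsto _).comp h1
  refine tendsto_of_tendsto_of_tendsto_of_le_of_le' hlow hup ?_ ?_
  · filter_upwards [eventually_gt_atTop 0, eventually_le_rpow hγ C,
      hb.eventually_lt_const one_pos] with n hn hC hb1
    refine le_trans ?_ (prod_one_sub_le_noneTrue (edgeProb f γ) pathEdges (paths n (m + 1)))
    rw [expectedPaths, Finset.sum_div, ← Finset.sum_neg_distrib, Real.exp_sum]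
    refine Finset.prod_le_prod (fun _ _ => (Real.exp_pos _).le) fun v hv => ?_
    exact exp_neg_div_le measureReal_nonneg
      (allTrue_pathEdges_le (edgeProb f γ) (edgeProb_le hf hn hC) (mem_paths.1 hv)) hb1
  · filter_upwards [eventually_gt_atTop 0, hover] with n hn hover
    rw [pathScale_eq_one h hn, one_pow, mul_one] at hover
    refine (janson (edgeProb f γ) pathEdges (paths n (m + 1))).trans (Real.exp_le_exp.2 ?_)
    exact add_le_add le_rfl hover

/-- Dividing the second moment bound by the squared mean leaves `1 / mean` plus `r / pathSum ^ 2`;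
both vanish because the limiting integral is positive. -/
theorem tendsto_missProb_supercritical (hf : Admissible f C) (hγ : 0 < γ) (hγ1 : γ < 1)
    (h : 1 < ((m + 1 : ℕ) + 1 : ℝ) * (1 - γ)) :
    Tendsto (missProb f γ (m + 1)) atTop (𝓝 0) := by
  obtain ⟨r, hr, hover⟩ := exists_pathOverlap_le hf hγ hγ1 (m + 1)
  have hc : 0 < ∫ u in openSimplex (m + 1), pathWeight f u := hf.integral_pathWeight_pos
  have hS := hf.tendsto_pathSum (m := m)
  have hscale := tendsto_pathScale_atTop h
  have hlim : Tendsto (fun n => (pathSum f (m + 1) n * pathScale γ (m + 1) n)⁻¹ +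
      r n / pathSum f (m + 1) n ^ 2) atTop (𝓝 0) := by
    have h1 := (hS.pos_mul_atTop hc hscale).inv_tendsto_atTop
    have h2 := hr.div (hS.pow 2) (by positivity)
    rw [zero_div] at h2
    simpa using! h1.add h2
  refine squeeze_zero' (Eventually.of_forall fun n => measureReal_nonneg) ?_ hlim
  filter_upwards [eventually_gt_atTop 0, eventually_le_rpow hγ C, hover, hS.eventually_const_lt hc,
    hscale.eventually_gt_atTop 0] with n hn hC hover hSn hsn
  have hmean := expectedPaths_eq (m := m + 1) hf hn hC
  have h1 : missProb f γ (m + 1) n * expectedPaths f γ (m + 1) n ^ 2 ≤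
      expectedPaths f γ (m + 1) n + pathOverlap f γ (m + 1) n :=
    noneTrue_mul_sq_le (edgeProb f γ) pathEdges (paths n (m + 1))
  rw [hmean] at h1
  have h2 : 0 < (pathSum f (m + 1) n * pathScale γ (m + 1) n) ^ 2 := by positivity
  calc missProb f γ (m + 1) n
      ≤ (pathSum f (m + 1) n * pathScale γ (m + 1) n + r n * pathScale γ (m + 1) n ^ 2) /
          (pathSum f (m + 1) n * pathScale γ (m + 1) n) ^ 2 :=
        (le_div_iff₀ h2).2 (h1.trans (by gcongr))
    _ = _ := by field_simp

end Limits

end BarakErdos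

/-! ### The three regimes -/

theorem corollary2 (f : ℝ → ℝ → ℝ)
    (hf : BarakErdos.RiemannIntegrable f)
    (hpos : ∀ x ∈ Icc (0 : ℝ) 1, ∀ y ∈ Icc (0 : ℝ) 1, 0 < f x y)
    (hleft : ∀ᵐ y ∂(volume.restrict (Icc (0 : ℝ) 1)),
      ContinuousWithinAt (Function.uncurry f) (Icc (0 : ℝ) 1 ×ˢ Icc (0 : ℝ) 1) (0, y))
    (hright : ∀ᵐ x ∂(volume.restrict (Icc (0 : ℝ) 1)),
      ContinuousWithinAt (Function.uncurry f) (Icc (0 : ℝ) 1 ×ˢ Icc (0 : ℝ) 1) (x, 1))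
    (γ : ℝ) (hγ : 0 < γ) (k : ℕ) (hk : 2 ≤ k) :
    IntegrableOn (BarakErdos.pathWeight f) (BarakErdos.openSimplex (k - 1)) volume ∧
    (1 ≤ γ ∨ (k : ℝ) < 1 / (1 - γ) →
      Tendsto (fun n : ℕ => BarakErdos.probShortestLE f γ n k) atTop (𝓝 0)) ∧
    (γ < 1 ∧ (k : ℝ) = 1 / (1 - γ) →
      Tendsto (fun n : ℕ => BarakErdos.probShortestLE f γ n k) atTop
        (𝓝 (1 - Real.exp (-BarakErdos.pathConst f k)))) ∧
    (γ < 1 ∧ 1 / (1 - γ) < (k : ℝ) →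
      Tendsto (fun n : ℕ => BarakErdos.probShortestLE f γ n k) atTop (𝓝 1)) := by
  open BarakErdos in
  obtain ⟨C, hC1, hC⟩ := hf.exists_le
  have hadm : Admissible f C :=
    { one_le := hC1
      pos := hpos
      le := hC
      continuousAt := hf.ae_continuousAt
      left := (ae_restrict_iff' measurableSet_Icc).1 hleft
      right := (ae_restrict_iff' measurableSet_Icc).1 hright }
  obtain ⟨m, rfl⟩ : ∃ m, k = m + 2 := ⟨k - 2, by omega⟩
  -- The union bound over subcritical lengths: all lengths in the first regime, and all lengths
  -- below `k` in the critical one.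
  have hsmall : ∀ l : ℕ, ((∀ j < l, (j + 1 : ℝ) * (1 - γ) < 1) →
      Tendsto (fun n => ∑ j ∈ Finset.range l, (1 - missProb f γ j n)) atTop (𝓝 0)) := by
    intro l hl
    have := tendsto_finsetSum (Finset.range l) fun j hj =>
      tendsto_one_sub_missProb_zero hadm hγ (hl j (Finset.mem_range.1 hj))
    simpa using this
  refine ⟨hadm.integrableOn_pathWeight, fun h => ?_, fun h => ?_, fun h => ?_⟩
  · have hl : ∀ j < m + 2, (j + 1 : ℝ) * (1 - γ) < 1 := by
      intro j hj
      rcases le_or_gt 1 γ with h1 | h1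
      · have : (j + 1 : ℝ) * (1 - γ) ≤ 0 :=
          mul_nonpos_of_nonneg_of_nonpos (by positivity) (by linarith)
        linarith
      · have h2 := (lt_div_iff₀ (sub_pos.2 h1)).1 (h.resolve_left (not_le.2 h1))
        have h3 : (j + 1 : ℝ) ≤ ((m + 2 : ℕ) : ℝ) := by exact_mod_cast hj
        exact (mul_le_mul_of_nonneg_right h3 (sub_pos.2 h1).le).trans_lt h2
    refine squeeze_zero' (Eventually.of_forall fun n => measureReal_nonneg) ?_ (hsmall _ hl)
    filter_upwards [eventually_ge_atTop 2] with n hn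
    exact probShortestLE_le_sum hn _
  · obtain ⟨h1, h2⟩ := h
    have hpos' := sub_pos.2 h1
    rw [eq_div_iff hpos'.ne'] at h2
    have h3 : ((m + 1 : ℕ) + 1 : ℝ) * (1 - γ) = 1 := by
      refine Eq.trans ?_ h2
      push_cast
      ring
    have hl : ∀ j < m + 1, (j + 1 : ℝ) * (1 - γ) < 1 := by
      intro j hj
      have h4 : (j + 1 : ℝ) < (m + 1 : ℕ) + 1 := by exact_mod_cast Nat.succ_lt_succ hj
      exact (mul_lt_mul_of_pos_right h4 hpos').trans_eq h3
    have hmiss := (tendsto_missProb_critical hadm hγ h1 h3).const_sub 1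
    have hup := (hsmall _ hl).add hmiss
    rw [zero_add] at hup
    -- The probability lies between that of a path with exactly `k` edges and this plus the
    -- vanishing contribution of shorter paths.
    refine tendsto_of_tendsto_of_tendsto_of_le_of_le' hmiss hup ?_ ?_
    · filter_upwards [eventually_ge_atTop 2] with n hn
      exact one_sub_missProb_le_probShortestLE hn (Nat.lt_succ_self _)
    · filter_upwards [eventually_ge_atTop 2] with n hn
      refine (probShortestLE_le_sum hn _).trans_eq ?_
      rw [Finset.sum_range_succ]
  · obtain ⟨h1, h2⟩ := h
    rw [div_lt_iff₀ (sub_pos.2 h1)] at h2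
    have h3 : 1 < ((m + 1 : ℕ) + 1 : ℝ) * (1 - γ) := by
      refine h2.trans_eq ?_
      push_cast
      ring
    have hmiss := (tendsto_missProb_supercritical hadm hγ h1 h3).const_sub 1
    rw [sub_zero] at hmiss
    refine tendsto_of_tendsto_of_tendsto_of_le_of_le' hmiss tendsto_const_nhds ?_ ?_
    · filter_upwards [eventually_ge_atTop 2] with n hn
      exact one_sub_missProb_le_probShortestLE hn (Nat.lt_succ_self _)
    · exact Eventually.of_forall fun n => measureReal_le_one
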